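/- Let $\alpha\in(0,1]$, let $W:\mathcal X\to\mathcal P(\mathcal Y)$ be a channel, i.e. an arbitrary function from a set $\mathcal X$ to the set $\mathcal P(\mathcal Y)$ of all probability measures on a measurable space $\mathcal Y$, and let $A$ be a non-empty convex set of finitely supported probability mass functions on $\mathcal X$. For $w,q\in\mathcal P(\mathcal Y)$ let $D_\alpha(w\|q)\in[0,\infty]$ be the order $\alpha$ Rényi divergence, $$D_\alpha(w\|q)=\frac1{\alpha-1}\ln\int\Big(\frac{dw}{d\nu}\Big)^{\alpha}\Big(\frac{dq}{d\nu}\Big)^{1-\alpha}d\nu\quad(\alpha\ne1),\qquad D_1(w\|q)=\int\frac{dw}{d\nu}\Big[\ln\frac{dw}{d\nu}-\ln\frac{dq}{d\nu}\Big]d\nu,$$ where $\nu$ is any measure with $w,q\ll\nu$ (for example $\nu=w+q$). For a finitely supported probability mass function $p$ on $\mathcal X$ put $$D_\alpha(W\|q|p)=\sum_x p(x)\,D_\alpha(W(x)\|q),\qquad I_\alpha(p;W)=\inf_{q\in\mathcal P(\mathcal Y)}D_\alpha(W\|q|p),\qquad C_{\alpha,W,A}=\sup_{p\in A}I_\alpha(p;W).$$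 Then $$\sup_{p\in A}\ \inf_{q\in\mathcal P(\mathcal Y)}D_\alpha(W\|q|p)=\inf_{q\in\mathcal P(\mathcal Y)}\ \sup_{p\in A}D_\alpha(W\|q|p).$$ Every finitely supported probability mass function $p$ on $\mathcal X$ has exactly one order $\alpha$ Augustin mean, i.e. there is exactly one $q_{\alpha,p}\in\mathcal P(\mathcal Y)$ with $I_\alpha(p;W)=D_\alpha(W\|q_{\alpha,p}|p)$. If $C_{\alpha,W,A}<\infty$, then there is exactly one $q_{\alpha,W,A}\in\mathcal P(\mathcal Y)$, called the order $\alpha$ Augustin center of $W$ for the constraint set $A$, such that $$C_{\alpha,W,A}=\sup_{p\in A}D_\alpha(W\|q_{\alpha,W,A}|p).$$ If moreover a sequence $(p^{(n)})$ in $A$ satisfies $\lim_{n\to\infty}I_\alpha(p^{(n)};W)=C_{\alpha,W,A}<\infty$, then the sequence $(q_{\alpha,p^{(n)}})$ of Augustin means is Cauchy for the total variation metric on $\mathcal P(\mathcal Y)$, it converges to $q_{\alpha,W,A}$, and $q_{\alpha,W,A}$ is its unique limit point. -/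

import Mathlib

open MeasureTheory Filter Topology

open scoped ENNReal

namespace Augustin

/-- `∫ (dw/dν)^α (dq/dν)^(1-α) dν`, with the dominating measure `ν = w + q`. -/
noncomputable def affinity {Y : Type*} [MeasurableSpace Y] (α : ℝ) (w q : ProbabilityMeasure Y) :
    ℝ≥0∞ :=
  ∫⁻ y, ((w : Measure Y).rnDeriv ((w : Measure Y) + (q : Measure Y)) y) ^ α *
      ((q : Measure Y).rnDeriv ((w : Measure Y) + (q : Measure Y)) y) ^ (1 - α)
    ∂((w : Measure Y) + (q : Measure Y))

/-- The formula `(1 / (α - 1)) * ln ∫ (dw/dν)^α (dq/dν)^(1-α) dν` for the Rényi divergence of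
order `α ≠ 1`, with values in the extended reals (`ln 0 = -∞`, `ln ∞ = ∞`). -/
noncomputable def renyiFormula {Y : Type*} [MeasurableSpace Y] (α : ℝ)
    (w q : ProbabilityMeasure Y) : EReal :=
  (((α - 1)⁻¹ : ℝ) : EReal) * ENNReal.log (affinity α w q)

/-- The Rényi divergence `D_α(w‖q)` of order `α` between probability measures; at order one it is
the Kullback-Leibler divergence. It is nonnegative, so it is taken in `[0, ∞]`; see
`coe_renyiDiv` for the orders `0 < α < 1`. -/
noncomputable def renyiDiv {Y : Type*} [MeasurableSpace Y] (α : ℝ) (w q : ProbabilityMeasure Y) :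
    ℝ≥0∞ :=
  if α = 1 then InformationTheory.klDiv (w : Measure Y) (q : Measure Y)
  else (renyiFormula α w q).toENNReal

theorem affinity_le_one {Y : Type*} [MeasurableSpace Y] {α : ℝ} (h0 : 0 < α) (h1 : α < 1)
    (w q : ProbabilityMeasure Y) : affinity α w q ≤ 1 := by
  have hw : (w : Measure Y) ≪ (w : Measure Y) + (q : Measure Y) :=
    Measure.AbsolutelyContinuous.rfl.add_right _
  have hq : (q : Measure Y) ≪ (w : Measure Y) + (q : Measure Y) := by
    rw [add_comm]; exact Measure.AbsolutelyContinuous.rfl.add_right _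
  have h := ENNReal.lintegral_mul_norm_pow_le
    (μ := (w : Measure Y) + (q : Measure Y))
    (Measure.measurable_rnDeriv (w : Measure Y) ((w : Measure Y) + (q : Measure Y))).aemeasurable
    (Measure.measurable_rnDeriv (q : Measure Y) ((w : Measure Y) + (q : Measure Y))).aemeasurable
    h0.le (sub_nonneg.2 h1.le) (by ring)
  rw [Measure.lintegral_rnDeriv hw, Measure.lintegral_rnDeriv hq] at h
  simpa [affinity] using h

/-- The truncation in the definition of `renyiDiv` changes nothing. -/
theorem coe_renyiDiv {Y : Type*} [MeasurableSpace Y] {α : ℝ} (h0 : 0 < α) (h1 : α < 1)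
    (w q : ProbabilityMeasure Y) : (renyiDiv α w q : EReal) = renyiFormula α w q := by
  rw [renyiDiv, if_neg h1.ne, EReal.coe_toENNReal]
  refine EReal.mul_nonneg_iff.2 (Or.inr ⟨?_, ENNReal.log_le_zero_iff.2 (affinity_le_one h0 h1 w q)⟩)
  exact_mod_cast inv_nonpos.2 (by linarith)

/-- The probability mass functions on `X` that are non-zero on finitely many points only. -/
def priors (X : Type*) : Set (X →₀ ℝ) :=
  {p | (∀ x, 0 ≤ p x) ∧ ∑ x ∈ p.support, p x = 1}

/-- The conditional Rényi divergence `D_α(W‖q|p) = ∑ x, p x * D_α(W x‖q)` of a channel `W`. -/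
noncomputable def condRenyiDiv {X Y : Type*} [MeasurableSpace Y] (α : ℝ)
    (W : X → ProbabilityMeasure Y) (q : ProbabilityMeasure Y) (p : X →₀ ℝ) : ℝ≥0∞ :=
  ∑ x ∈ p.support, ENNReal.ofReal (p x) * renyiDiv α (W x) q

/-- The Augustin information `I_α(p; W)` of order `α` for the prior `p`. -/
noncomputable def information {X Y : Type*} [MeasurableSpace Y] (α : ℝ)
    (W : X → ProbabilityMeasure Y) (p : X →₀ ℝ) : ℝ≥0∞ :=
  ⨅ q : ProbabilityMeasure Y, condRenyiDiv α W q p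

/-- The Augustin capacity `C_{α,W,A}` of order `α` for the constraint set `A`. -/
noncomputable def capacity {X Y : Type*} [MeasurableSpace Y] (α : ℝ)
    (W : X → ProbabilityMeasure Y) (A : Set (X →₀ ℝ)) : ℝ≥0∞ :=
  ⨆ p ∈ A, information α W p

/-- `q` is an Augustin mean of order `α` for the prior `p`. -/
def IsMean {X Y : Type*} [MeasurableSpace Y] (α : ℝ)
    (W : X → ProbabilityMeasure Y) (p : X →₀ ℝ) (q : ProbabilityMeasure Y) : Prop :=
  information α W p = condRenyiDiv α W q p

/-- `q` is an Augustin center of order `α` for the constraint set `A`. -/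
def IsCenter {X Y : Type*} [MeasurableSpace Y] (α : ℝ)
    (W : X → ProbabilityMeasure Y) (A : Set (X →₀ ℝ)) (q : ProbabilityMeasure Y) : Prop :=
  capacity α W A = ⨆ p ∈ A, condRenyiDiv α W q p

/-- The total variation distance `‖P - Q‖ = 2 * sup_E |P E - Q E|`, with `E` ranging over the
measurable sets. -/
noncomputable def tvDist {Y : Type*} [MeasurableSpace Y] (P Q : ProbabilityMeasure Y) : ℝ :=
  2 * ⨆ E : {E : Set Y // MeasurableSet E},
    |(P : Measure Y).real E.1 - (Q : Measure Y).real E.1|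

/-- The sequence `m` is Cauchy for the total variation metric. -/
def IsCauchyTV {Y : Type*} [MeasurableSpace Y] (m : ℕ → ProbabilityMeasure Y) : Prop :=
  ∀ ε : ℝ, 0 < ε → ∃ N : ℕ, ∀ i ≥ N, ∀ j ≥ N, tvDist (m i) (m j) < ε

/-- `q` is a limit point of the sequence `m` for the total variation metric. -/
def IsLimitPointTV {Y : Type*} [MeasurableSpace Y] (m : ℕ → ProbabilityMeasure Y)
    (q : ProbabilityMeasure Y) : Prop :=
  ∀ ε : ℝ, 0 < ε → ∃ᶠ i in atTop, tvDist (m i) q < ε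

end Augustin

namespace Augustin

/-! The engine is a uniform convexity of `q ↦ D_α(W‖q|p)`, stated in `two_mul_information_add_le`.
For output laws with densities `g₁`, `g₂`, take the pointwise power mean of order `1 - α` (the
geometric mean if `α = 1`) and divide it by its mass `z`. For `α < 1` the integral of `f ^ α * g ^
(1 - α)` is averaged exactly by this mean, and `-log` is convex; for `α = 1` the logarithm itself is
averaged exactly. Normalising then lowers the divergence from every `W x` by the same `-log z ≥ 1 -
z`, and a quantitative mean inequality gives `1 - z ≥ α / 64 * ‖q₁ - q₂‖²`.

Hence minimising sequences in `q` are Cauchy. Total variation is complete (`exists_tendsto_tvDist`)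
and the divergence is lower semicontinuous (`condRenyiDiv_le_liminf`), so means exist. Taking `q₁`
to be a mean gives quadratic growth around it (`IsMean.add_le`), hence uniqueness.

For the center, the divergence is affine in the prior, so the mean `q` of a mixture `a • p₁ + b •
p₂` in `A` satisfies `a * D(q|p₁) + b * D(q|p₂) ≤ C` (`exists_mixture_le`). Equal weights show that
priors of nearly maximal information have nearby means, which therefore converge to some `qc`.
Giving an arbitrary `p'` in `A` a vanishing weight yields `D(qc|p') ≤ C` (`exists_isCenter`). Such a
`qc` closes the minimax gap, and quadratic growth pulls the means of every capacity-achieving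
sequence to it. -/

/-- `g` is a real-valued version of the density of `q` with respect to `ν`. -/
structure IsDensity {Y : Type*} [MeasurableSpace Y] (ν q : Measure Y) (g : Y → ℝ) : Prop where
  measurable : Measurable g
  nonneg : ∀ y, 0 ≤ g y
  eq : q = ν.withDensity fun y => ENNReal.ofReal (g y)

/-! ### Densities with respect to a common dominating measure -/

section Density

variable {Y : Type*} [MeasurableSpace Y] {ν w q : Measure Y} {f g : Y → ℝ}

theorem exists_isDensity [SigmaFinite ν] [SigmaFinite q] (h : q ≪ ν) :
    ∃ g, IsDensity ν q g := by
  refine ⟨fun y => (q.rnDeriv ν y).toReal, (Measure.measurable_rnDeriv q ν).ennreal_toReal,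
    fun y => ENNReal.toReal_nonneg, ?_⟩
  conv_lhs => rw [← Measure.withDensity_rnDeriv_eq q ν h]
  refine withDensity_congr_ae ?_
  filter_upwards [Measure.rnDeriv_lt_top q ν] with y hy
  rw [ENNReal.ofReal_toReal hy.ne]

theorem IsDensity.measurable_ofReal (h : IsDensity ν q g) :
    Measurable fun y => ENNReal.ofReal (g y) := h.measurable.ennreal_ofReal

theorem IsDensity.lintegral_eq (h : IsDensity ν q g) :
    ∫⁻ y, ENNReal.ofReal (g y) ∂ν = q Set.univ := by
  rw [h.eq, withDensity_apply _ MeasurableSet.univ, Measure.restrict_univ]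

theorem IsDensity.lintegral_mul (h : IsDensity ν q g) {k : Y → ℝ≥0∞} (hk : Measurable k) :
    ∫⁻ y, k y ∂q = ∫⁻ y, ENNReal.ofReal (g y) * k y ∂ν := by
  conv_lhs => rw [h.eq]
  rw [lintegral_withDensity_eq_lintegral_mul _ h.measurable_ofReal hk]
  rfl

theorem IsDensity.integrable [IsFiniteMeasure q] (h : IsDensity ν q g) : Integrable g ν := by
  refine ⟨h.measurable.aestronglyMeasurable, ?_⟩
  rw [hasFiniteIntegral_iff_ofReal (Eventually.of_forall h.nonneg), h.lintegral_eq]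
  exact measure_lt_top q _

theorem IsDensity.real_eq_setIntegral (h : IsDensity ν q g) {E : Set Y}
    (hE : MeasurableSet E) : q.real E = ∫ y in E, g y ∂ν := by
  rw [integral_eq_lintegral_of_nonneg_ae (Eventually.of_forall h.nonneg)
    h.measurable.aestronglyMeasurable, Measure.real]
  conv_lhs => rw [h.eq, withDensity_apply _ hE]

theorem IsDensity.integral_eq_one [IsProbabilityMeasure q] (h : IsDensity ν q g) :
    ∫ y, g y ∂ν = 1 := by
  have := h.real_eq_setIntegral MeasurableSet.univ
  rw [Measure.restrict_univ] at this
  rw [← this, probReal_univ]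

theorem IsDensity.rnDeriv_mul [SigmaFinite ν] [SigmaFinite w] [SigmaFinite q]
    (hf : IsDensity ν w f) (hg : IsDensity ν q g) (hwq : w ≪ q) :
    ∀ᵐ y ∂ν, w.rnDeriv q y * ENNReal.ofReal (g y) = ENNReal.ofReal (f y) := by
  have h1 : w.rnDeriv ν =ᵐ[ν] fun y => ENNReal.ofReal (f y) := by
    conv_lhs => rw [hf.eq]
    exact Measure.rnDeriv_withDensity ν hf.measurable_ofReal
  have h2 : q.rnDeriv ν =ᵐ[ν] fun y => ENNReal.ofReal (g y) := by
    conv_lhs => rw [hg.eq]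
    exact Measure.rnDeriv_withDensity ν hg.measurable_ofReal
  filter_upwards [h1, h2, Measure.rnDeriv_mul_rnDeriv (κ := ν) hwq] with y e1 e2 e3
  rw [← e1, ← e2, ← e3]; rfl

theorem IsDensity.add (hf : IsDensity ν w f) (hg : IsDensity ν q g) :
    IsDensity ν (w + q) fun y => f y + g y := by
  refine ⟨hf.measurable.add hg.measurable, fun y => add_nonneg (hf.nonneg y) (hg.nonneg y), ?_⟩
  conv_lhs => rw [hf.eq, hg.eq]
  rw [← withDensity_add_left hf.measurable_ofReal]
  congr 1
  ext y
  exact (ENNReal.ofReal_add (hf.nonneg y) (hg.nonneg y)).symm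

end Density

/-! ### The divergences computed with an arbitrary dominating measure -/

variable {Y : Type*} [MeasurableSpace Y] {ν : Measure Y} {f g g₁ g₂ : Y → ℝ}
  {w q q₁ q₂ : ProbabilityMeasure Y}

theorem exists_probabilityMeasure_isDensity (hm : Measurable g) (h0 : ∀ y, 0 ≤ g y)
    (hi : Integrable g ν) (h1 : ∫ y, g y ∂ν = 1) :
    ∃ q : ProbabilityMeasure Y, IsDensity ν (q : Measure Y) g := by
  refine ⟨⟨ν.withDensity fun y => ENNReal.ofReal (g y), ⟨?_⟩⟩, hm, h0, rfl⟩
  rw [withDensity_apply _ MeasurableSet.univ, Measure.restrict_univ,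
    ← ofReal_integral_eq_lintegral_ofReal hi (Eventually.of_forall h0), h1, ENNReal.ofReal_one]

theorem affinity_eq_lintegral [SigmaFinite ν] {α : ℝ} (h0 : 0 < α) (h1 : α < 1)
    (hf : IsDensity ν w f) (hg : IsDensity ν q g) :
    affinity α w q = ∫⁻ y, ENNReal.ofReal (f y ^ α * g y ^ (1 - α)) ∂ν := by
  have hs : 0 ≤ 1 - α := by linarith
  have hw : (w : Measure Y) ≪ (w : Measure Y) + (q : Measure Y) :=
    Measure.AbsolutelyContinuous.rfl.add_right _
  have hq : (q : Measure Y) ≪ (w : Measure Y) + (q : Measure Y) := by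
    rw [add_comm]; exact Measure.AbsolutelyContinuous.rfl.add_right _
  rw [affinity, (hf.add hg).lintegral_mul
    (k := fun y => (w : Measure Y).rnDeriv ((w : Measure Y) + (q : Measure Y)) y ^ α *
      (q : Measure Y).rnDeriv ((w : Measure Y) + (q : Measure Y)) y ^ (1 - α))
    (((Measure.measurable_rnDeriv _ _).pow_const _).mul
      ((Measure.measurable_rnDeriv _ _).pow_const _))]
  refine lintegral_congr_ae ?_
  filter_upwards [hf.rnDeriv_mul (hf.add hg) hw, hg.rnDeriv_mul (hf.add hg) hq] with y e1 e2
  rw [ENNReal.ofReal_mul (Real.rpow_nonneg (hf.nonneg y) _),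
    ← ENNReal.ofReal_rpow_of_nonneg (hf.nonneg y) h0.le,
    ← ENNReal.ofReal_rpow_of_nonneg (hg.nonneg y) hs, ← e1, ← e2,
    ENNReal.mul_rpow_of_nonneg _ _ h0.le, ENNReal.mul_rpow_of_nonneg _ _ hs]
  -- The exponents sum to one, so the density `c` of `w + q` splits between the two factors.
  set c := ENNReal.ofReal (f y + g y)
  have hc : c = c ^ α * c ^ (1 - α) := by
    rw [← ENNReal.rpow_add_of_nonneg _ _ h0.le hs]; simp
  conv_lhs => rw [hc]
  ring

/-- The integrand of the Kullback-Leibler divergence in terms of densities. -/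
noncomputable def klIntegrand (a b : ℝ) : ℝ≥0∞ :=
  if b = 0 then (if a = 0 then 0 else ⊤) else ENNReal.ofReal (b * InformationTheory.klFun (a / b))

theorem measurable_klIntegrand (hf : Measurable f) (hg : Measurable g) :
    Measurable fun y => klIntegrand (f y) (g y) := by
  unfold klIntegrand
  refine Measurable.ite (hg (measurableSet_singleton 0))
    (Measurable.ite (hf (measurableSet_singleton 0)) measurable_const measurable_const) ?_
  exact (hg.mul (InformationTheory.measurable_klFun.comp (hf.div hg))).ennreal_ofReal

/-- The terms `b - a` in `klFun` make the integrand nonnegative pointwise, so Kullback-Leibler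
divergence needs no integrability conditions. If `w` is not absolutely continuous with respect to
`q`, the value `⊤` of the integrand at `b = 0 < a` is taken on a set of positive measure. -/
theorem klDiv_eq_lintegral [SigmaFinite ν] (hf : IsDensity ν w f) (hg : IsDensity ν q g) :
    InformationTheory.klDiv (w : Measure Y) (q : Measure Y) =
      ∫⁻ y, klIntegrand (f y) (g y) ∂ν := by
  by_cases hwq : (w : Measure Y) ≪ (q : Measure Y)
  · rw [InformationTheory.klDiv_eq_lintegral_klFun_of_ac hwq, hg.lintegral_mul
      (k := fun y => ENNReal.ofReal (InformationTheory.klFun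
        ((w : Measure Y).rnDeriv (q : Measure Y) y).toReal))
      (InformationTheory.measurable_klFun.comp
        (Measure.measurable_rnDeriv _ _).ennreal_toReal).ennreal_ofReal]
    refine lintegral_congr_ae ?_
    filter_upwards [hf.rnDeriv_mul hg hwq] with y hy
    by_cases hb : g y = 0
    · have : f y = 0 := by
        rw [hb] at hy
        simp only [ENNReal.ofReal_zero, mul_zero] at hy
        exact le_antisymm (ENNReal.ofReal_eq_zero.1 hy.symm) (hf.nonneg y)
      simp [klIntegrand, hb, this]
    · have hb' : 0 < g y := lt_of_le_of_ne (hg.nonneg y) (Ne.symm hb)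
      have := congrArg ENNReal.toReal hy
      rw [ENNReal.toReal_mul, ENNReal.toReal_ofReal (hg.nonneg y),
        ENNReal.toReal_ofReal (hf.nonneg y)] at this
      rw [klIntegrand, if_neg hb, ← ENNReal.ofReal_mul (hg.nonneg y), ← this,
        mul_div_cancel_right₀ _ hb]
  · rw [InformationTheory.klDiv_of_not_ac hwq]
    symm
    by_contra hne
    apply hwq
    have h0 : ∀ᵐ y ∂ν, g y = 0 → f y = 0 := by
      filter_upwards [ae_lt_top (measurable_klIntegrand hf.measurable hg.measurable) hne]
        with y hy hgy
      by_contra hfy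
      simp [klIntegrand, hgy, hfy] at hy
    refine Measure.AbsolutelyContinuous.mk fun s hs hqs => ?_
    rw [hf.eq, withDensity_apply _ hs]
    rw [hg.eq, withDensity_apply _ hs, lintegral_eq_zero_iff hg.measurable_ofReal] at hqs
    rw [lintegral_eq_zero_iff hf.measurable_ofReal]
    filter_upwards [hqs, ae_restrict_of_ae h0] with y hy hy'
    have : g y = 0 := le_antisymm (ENNReal.ofReal_eq_zero.1 hy) (hg.nonneg y)
    simp [hy' this]

/-! ### The total variation metric and its comparison with the `L¹` distance -/

section TotalVariation

variable {Y : Type*} [MeasurableSpace Y] {P Q R : ProbabilityMeasure Y}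

theorem bddAbove_tvDist (P Q : ProbabilityMeasure Y) :
    BddAbove (Set.range fun E : {E : Set Y // MeasurableSet E} =>
      |(P : Measure Y).real E.1 - (Q : Measure Y).real E.1|) := by
  refine ⟨1, ?_⟩
  rintro _ ⟨E, rfl⟩
  have h1 : (P : Measure Y).real E.1 ≤ 1 := measureReal_le_one
  have h2 : (Q : Measure Y).real E.1 ≤ 1 := measureReal_le_one
  have h3 : 0 ≤ (P : Measure Y).real E.1 := measureReal_nonneg
  have h4 : 0 ≤ (Q : Measure Y).real E.1 := measureReal_nonneg
  exact abs_le.2 ⟨by linarith, by linarith⟩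

theorem two_mul_abs_sub_le_tvDist (P Q : ProbabilityMeasure Y) {E : Set Y}
    (hE : MeasurableSet E) :
    2 * |(P : Measure Y).real E - (Q : Measure Y).real E| ≤ tvDist P Q := by
  have := le_ciSup (bddAbove_tvDist P Q) ⟨E, hE⟩
  rw [tvDist]
  linarith

theorem tvDist_le {c : ℝ}
    (h : ∀ E, MeasurableSet E → 2 * |(P : Measure Y).real E - (Q : Measure Y).real E| ≤ c) :
    tvDist P Q ≤ c := by
  have : Nonempty {E : Set Y // MeasurableSet E} := ⟨⟨∅, MeasurableSet.empty⟩⟩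
  have : (⨆ E : {E : Set Y // MeasurableSet E},
      |(P : Measure Y).real E.1 - (Q : Measure Y).real E.1|) ≤ c / 2 :=
    ciSup_le fun E => by linarith [h E.1 E.2]
  rw [tvDist]
  linarith

theorem tvDist_nonneg (P Q : ProbabilityMeasure Y) : 0 ≤ tvDist P Q := by
  simpa using two_mul_abs_sub_le_tvDist P Q MeasurableSet.empty

theorem tvDist_comm (P Q : ProbabilityMeasure Y) : tvDist P Q = tvDist Q P := by
  simp only [tvDist, abs_sub_comm]

theorem tvDist_triangle (P Q R : ProbabilityMeasure Y) :
    tvDist P R ≤ tvDist P Q + tvDist Q R := by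
  refine tvDist_le fun E hE => ?_
  have h1 := two_mul_abs_sub_le_tvDist P Q hE
  have h2 := two_mul_abs_sub_le_tvDist Q R hE
  have h3 := abs_sub_le ((P : Measure Y).real E) ((Q : Measure Y).real E) ((R : Measure Y).real E)
  linarith

theorem eq_of_tvDist_le_zero (h : tvDist P Q ≤ 0) : P = Q := by
  refine Subtype.ext (Measure.ext fun E hE => ?_)
  have h1 := two_mul_abs_sub_le_tvDist P Q hE
  have h2 : (P : Measure Y).real E - (Q : Measure Y).real E = 0 :=
    abs_eq_zero.1 (le_antisymm (by linarith) (abs_nonneg _))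
  change (P : Measure Y) E = (Q : Measure Y) E
  exact (measureReal_eq_measureReal_iff (measure_ne_top _ _) (measure_ne_top _ _)).1 (sub_eq_zero.1 h2)

theorem eq_of_tendsto_tvDist {m : ℕ → ProbabilityMeasure Y}
    (hP : Tendsto (fun n => tvDist (m n) P) atTop (𝓝 0))
    (hQ : Tendsto (fun n => tvDist (m n) Q) atTop (𝓝 0)) : P = Q := by
  refine eq_of_tvDist_le_zero (ge_of_tendsto' (by simpa using hP.add hQ) fun n => ?_)
  have := tvDist_triangle P (m n) Q
  rwa [tvDist_comm P (m n)] at this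

theorem isCauchyTV_of_tendsto {m : ℕ → ProbabilityMeasure Y}
    (hP : Tendsto (fun n => tvDist (m n) P) atTop (𝓝 0)) : IsCauchyTV m := by
  intro ε hε
  obtain ⟨N, hN⟩ := eventually_atTop.1 (hP.eventually (gt_mem_nhds (half_pos hε)))
  refine ⟨N, fun i hi j hj => ?_⟩
  have h1 := tvDist_triangle (m i) P (m j)
  rw [tvDist_comm P] at h1
  linarith [hN i hi, hN j hj]

theorem isLimitPointTV_iff_of_tendsto {m : ℕ → ProbabilityMeasure Y}
    (hP : Tendsto (fun n => tvDist (m n) P) atTop (𝓝 0)) : IsLimitPointTV m Q ↔ Q = P := by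
  constructor
  · intro h
    refine eq_of_tvDist_le_zero (le_of_forall_pos_le_add fun ε hε => ?_)
    obtain ⟨n, h1, h2⟩ :=
      ((h (ε / 2) (half_pos hε)).and_eventually (hP.eventually (gt_mem_nhds (half_pos hε)))).exists
    have := tvDist_triangle Q (m n) P
    rw [tvDist_comm Q (m n)] at this
    linarith
  · rintro rfl ε hε
    exact (hP.eventually (gt_mem_nhds hε)).frequently

variable {ν : Measure Y} {f g : Y → ℝ}

/-- The Hahn set `{g ≤ f}` realises the integral; its complement contributes the same amount because
both total masses are one. -/
theorem integral_abs_sub_le_tvDist (hf : IsDensity ν P f) (hg : IsDensity ν Q g) :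
    ∫ y, |f y - g y| ∂ν ≤ tvDist P Q := by
  have hE : MeasurableSet {y | g y ≤ f y} := measurableSet_le hg.measurable hf.measurable
  have hi : Integrable (fun y => f y - g y) ν := hf.integrable.sub hg.integrable
  have h1 : ∫ y in {y | g y ≤ f y}, |f y - g y| ∂ν = ∫ y in {y | g y ≤ f y}, (f y - g y) ∂ν :=
    setIntegral_congr_fun hE fun y hy => abs_of_nonneg (sub_nonneg.2 hy)
  have h2 : ∫ y in {y | g y ≤ f y}ᶜ, |f y - g y| ∂ν =
      ∫ y in {y | g y ≤ f y}ᶜ, -(f y - g y) ∂ν :=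
    setIntegral_congr_fun hE.compl fun y hy => abs_of_nonpos (sub_nonpos.2 (not_le.1 (show ¬ g y ≤ f y from hy)).le)
  rw [← integral_add_compl hE hi.abs, h1, h2, integral_neg,
    integral_sub hf.integrable.integrableOn hg.integrable.integrableOn,
    integral_sub hf.integrable.integrableOn hg.integrable.integrableOn,
    ← hf.real_eq_setIntegral hE, ← hg.real_eq_setIntegral hE,
    ← hf.real_eq_setIntegral hE.compl, ← hg.real_eq_setIntegral hE.compl,
    probReal_compl_eq_one_sub hE, probReal_compl_eq_one_sub hE]
  have := two_mul_abs_sub_le_tvDist P Q hE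
  have := le_abs_self ((P : Measure Y).real {y | g y ≤ f y} - (Q : Measure Y).real {y | g y ≤ f y})
  linarith

theorem tvDist_le_two_mul_integral (hf : IsDensity ν P f) (hg : IsDensity ν Q g) :
    tvDist P Q ≤ 2 * ∫ y, |f y - g y| ∂ν := by
  have hi : Integrable (fun y => f y - g y) ν := hf.integrable.sub hg.integrable
  refine tvDist_le fun E hE => ?_
  rw [hf.real_eq_setIntegral hE, hg.real_eq_setIntegral hE,
    ← integral_sub hf.integrable.integrableOn hg.integrable.integrableOn]
  have h1 := abs_integral_le_integral_abs (μ := ν.restrict E) (f := fun y => f y - g y)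
  have h2 := setIntegral_le_integral (s := E) hi.abs (Eventually.of_forall fun y => abs_nonneg _)
  linarith

end TotalVariation

/-! ### A quantitative power mean inequality -/

section PowerMean

/-- The power mean of order `s` of two real numbers, with equal weights. -/
noncomputable def powMean (s a b : ℝ) : ℝ := ((a ^ s + b ^ s) / 2) ^ s⁻¹

theorem powMean_nonneg {s a b : ℝ} (ha : 0 ≤ a) (hb : 0 ≤ b) : 0 ≤ powMean s a b := by
  have := Real.rpow_nonneg ha s
  have := Real.rpow_nonneg hb s
  exact Real.rpow_nonneg (by positivity) _

theorem powMean_rpow {s a b : ℝ} (hs : 0 < s) (ha : 0 ≤ a) (hb : 0 ≤ b) :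
    powMean s a b ^ s = (a ^ s + b ^ s) / 2 := by
  have := Real.rpow_nonneg ha s
  have := Real.rpow_nonneg hb s
  rw [powMean, Real.rpow_inv_rpow (by positivity) hs.ne']

theorem powMean_mul {s a b m : ℝ} (hs : 0 < s) (ha : 0 ≤ a) (hb : 0 ≤ b) (hm : 0 ≤ m) :
    powMean s (m * a) (m * b) = m * powMean s a b := by
  have := Real.rpow_nonneg ha s
  have := Real.rpow_nonneg hb s
  have h := Real.rpow_nonneg hm s
  rw [powMean, powMean, Real.mul_rpow hm ha, Real.mul_rpow hm hb, ← mul_add, mul_div_assoc,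
    Real.mul_rpow h (by positivity), Real.rpow_rpow_inv hm hs.ne']

/-- Power means increase with the order, and at order `1 / 2` the gap to the arithmetic mean is
exactly `(√a - √b) ^ 2 / 4`. -/
theorem powMean_add_le_of_le_half {s a b : ℝ} (hs : 0 < s) (hs1 : s ≤ 1 / 2) (ha : 0 ≤ a)
    (hb : 0 ≤ b) : powMean s a b + (√a - √b) ^ 2 / 4 ≤ (a + b) / 2 := by
  have h1 : 1 ≤ (2 * s)⁻¹ := (one_le_inv₀ (by positivity)).2 (by linarith)
  have h2 := (convexOn_rpow h1).2 (Set.mem_Ici.2 (Real.rpow_nonneg ha s))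
    (Set.mem_Ici.2 (Real.rpow_nonneg hb s))
    (show (0 : ℝ) ≤ 1 / 2 by norm_num) (show (0 : ℝ) ≤ 1 / 2 by norm_num) (by norm_num)
  simp only [smul_eq_mul] at h2
  have h3 : ∀ x : ℝ, 0 ≤ x → (x ^ s) ^ (2 * s)⁻¹ = √x := fun x hx => by
    rw [← Real.rpow_mul hx, Real.sqrt_eq_rpow]
    congr 1
    field_simp
  rw [h3 a ha, h3 b hb] at h2
  have hn : 0 ≤ 1 / 2 * a ^ s + 1 / 2 * b ^ s := by
    have := Real.rpow_nonneg ha s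
    have := Real.rpow_nonneg hb s
    positivity
  have h4 : powMean s a b = ((1 / 2 * a ^ s + 1 / 2 * b ^ s) ^ (2 * s)⁻¹) ^ 2 := by
    rw [powMean, ← Real.rpow_natCast, ← Real.rpow_mul hn]
    congr 1
    · ring
    · push_cast; field_simp
  have h5 := pow_le_pow_left₀ (Real.rpow_nonneg hn _) h2 2
  rw [← h4] at h5
  nlinarith [Real.sq_sqrt ha, Real.sq_sqrt hb]

/-- Here `s` is the combination of `1 / 2` and `1` with weights `2 * (1 - s)` and `2 * s - 1`, so `z
^ s` lies below the same combination of `√z` and `z`. When the arithmetic mean is one, the outer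
exponent `s⁻¹ ≥ 1` can only decrease the result. -/
theorem powMean_add_le_of_half_le {s x y : ℝ} (hs : 1 / 2 ≤ s) (hs1 : s < 1) (hx : 0 ≤ x)
    (hy : 0 ≤ y) (hxy : x + y = 2) : powMean s x y + (1 - s) * (√x - √y) ^ 2 / 4 ≤ 1 := by
  have h1 : ∀ z : ℝ, 0 ≤ z → z ^ s ≤ 2 * (1 - s) * √z + (2 * s - 1) * z := fun z hz => by
    have h := Real.geom_mean_le_arith_mean2_weighted (w₁ := 2 * (1 - s)) (w₂ := 2 * s - 1)
      (by linarith) (by linarith) (Real.sqrt_nonneg z) hz (by ring)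
    refine le_trans (le_of_eq ?_) h
    rw [Real.sqrt_eq_rpow, ← Real.rpow_mul hz,
      ← Real.rpow_add_of_nonneg hz (by linarith) (by linarith)]
    congr 1
    ring
  have h2 := h1 x hx
  have h3 := h1 y hy
  have hP : (x ^ s + y ^ s) / 2 ≤ 1 - (1 - s) * (√x - √y) ^ 2 / 4 := by
    have e1 := Real.sq_sqrt hx
    have e2 := Real.sq_sqrt hy
    have e3 : (√x - √y) ^ 2 / 4 ≤ 2 - √x - √y := by nlinarith [sq_nonneg (2 - √x - √y)]
    have e4 := mul_le_mul_of_nonneg_left e3 (sub_nonneg.2 hs1.le)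
    have e5 : (x ^ s + y ^ s) / 2 ≤ (1 - s) * (√x + √y) + (2 * s - 1) := by
      nlinarith
    nlinarith
  have hP0 : 0 ≤ (x ^ s + y ^ s) / 2 := by
    have := Real.rpow_nonneg hx s
    have := Real.rpow_nonneg hy s
    positivity
  have hP1 : (x ^ s + y ^ s) / 2 ≤ 1 := by nlinarith [sq_nonneg (√x - √y)]
  have h4 : powMean s x y ≤ (x ^ s + y ^ s) / 2 :=
    Real.rpow_le_self_of_le_one hP0 hP1 ((one_le_inv₀ (by linarith)).2 hs1.le)
  linarith

theorem powMean_add_le {s a b : ℝ} (hs : 0 < s) (hs1 : s < 1) (ha : 0 ≤ a) (hb : 0 ≤ b) :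
    powMean s a b + (1 - s) * (√a - √b) ^ 2 / 4 ≤ (a + b) / 2 := by
  rcases le_total s (1 / 2) with h | h
  · have := powMean_add_le_of_le_half hs h ha hb
    nlinarith [sq_nonneg (√a - √b)]
  · rcases (add_nonneg ha hb).eq_or_lt with h0 | h0
    · obtain rfl : a = 0 := by linarith
      obtain rfl : b = 0 := by linarith
      simp [powMean, Real.zero_rpow hs.ne', Real.zero_rpow (inv_ne_zero hs.ne')]
    -- Both sides are homogeneous of degree one, which allows the normalisation `a + b = 2`.
    · set m := (a + b) / 2 with hm
      have hm0 : 0 < m := by positivity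
      have key := powMean_add_le_of_half_le h hs1 (div_nonneg ha hm0.le) (div_nonneg hb hm0.le)
        (by rw [← add_div, hm]; field_simp)
      have ea : a = m * (a / m) := by field_simp
      have eb : b = m * (b / m) := by field_simp
      have e1 : powMean s a b = m * powMean s (a / m) (b / m) := by
        rw [← powMean_mul hs (div_nonneg ha hm0.le) (div_nonneg hb hm0.le) hm0.le, ← ea, ← eb]
      have e2 : (√a - √b) ^ 2 = m * (√(a / m) - √(b / m)) ^ 2 := by
        have : (√a - √b) = √m * (√(a / m) - √(b / m)) := by
          rw [mul_sub, ← Real.sqrt_mul hm0.le, ← Real.sqrt_mul hm0.le, ← ea, ← eb]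
        rw [this, mul_pow, Real.sq_sqrt hm0.le]
      rw [e1, e2]
      nlinarith

end PowerMean

/-! ### Pointwise identities for the Kullback-Leibler integrand -/

section KLIntegrand

theorem mul_klFun_div {a b : ℝ} (ha : 0 ≤ a) (hb : 0 < b) :
    b * InformationTheory.klFun (a / b) = a * Real.log a - a * Real.log b + b - a := by
  rcases ha.eq_or_lt with rfl | ha
  · simp [InformationTheory.klFun_zero]
  · rw [InformationTheory.klFun_apply, Real.log_div ha.ne' hb.ne']
    field_simp

theorem klIntegrand_of_pos {a b : ℝ} (ha : 0 ≤ a) (hb : 0 < b) :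
    klIntegrand a b = ENNReal.ofReal (a * Real.log a - a * Real.log b + b - a) := by
  rw [klIntegrand, if_neg hb.ne', mul_klFun_div ha hb]

theorem klIntegrand_real_nonneg {a b : ℝ} (ha : 0 ≤ a) (hb : 0 < b) :
    0 ≤ a * Real.log a - a * Real.log b + b - a := by
  rw [← mul_klFun_div ha hb]
  exact mul_nonneg hb.le (InformationTheory.klFun_nonneg (div_nonneg ha hb.le))

theorem klIntegrand_zero_left {b : ℝ} (hb : 0 ≤ b) : klIntegrand 0 b = ENNReal.ofReal b := by
  rcases hb.eq_or_lt with rfl | hb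
  · simp [klIntegrand]
  · rw [klIntegrand_of_pos le_rfl hb]; simp

theorem klIntegrand_zero_right {a : ℝ} (ha : a ≠ 0) : klIntegrand a 0 = ⊤ := by
  simp [klIntegrand, ha]

/-- The logarithm of the geometric mean is the average of the logarithms. The linear terms are
distributed over the two sides so that no subtraction occurs in `ℝ≥0∞`. -/
theorem two_mul_klIntegrand_sqrt {a b c : ℝ} (ha : 0 ≤ a) (hb : 0 ≤ b) (hc : 0 ≤ c) :
    2 * klIntegrand a (√(b * c)) + (ENNReal.ofReal b + ENNReal.ofReal c) =
      klIntegrand a b + klIntegrand a c + 2 * ENNReal.ofReal (√(b * c)) := by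
  rcases ha.eq_or_lt with rfl | ha
  · rw [klIntegrand_zero_left hb, klIntegrand_zero_left hc,
      klIntegrand_zero_left (Real.sqrt_nonneg _), add_comm]
  rcases hb.eq_or_lt with rfl | hb
  · simp [klIntegrand_zero_right ha.ne']
  rcases hc.eq_or_lt with rfl | hc
  · simp [klIntegrand_zero_right ha.ne']
  have hbc : 0 < √(b * c) := Real.sqrt_pos.2 (mul_pos hb hc)
  have h2 : (2 : ℝ≥0∞) = ENNReal.ofReal 2 := by simp
  have k1 := klIntegrand_real_nonneg ha.le hb
  have k2 := klIntegrand_real_nonneg ha.le hc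
  have k3 := klIntegrand_real_nonneg ha.le hbc
  rw [klIntegrand_of_pos ha.le hb, klIntegrand_of_pos ha.le hc, klIntegrand_of_pos ha.le hbc, h2,
    ← ENNReal.ofReal_mul (by norm_num), ← ENNReal.ofReal_mul (by norm_num),
    ← ENNReal.ofReal_add hb.le hc.le, ← ENNReal.ofReal_add (by positivity) (by positivity),
    ← ENNReal.ofReal_add k1 k2, ← ENNReal.ofReal_add (by positivity) (by positivity)]
  congr 1
  have : Real.log (√(b * c)) = (Real.log b + Real.log c) / 2 := by
    rw [Real.log_sqrt (by positivity), Real.log_mul hb.ne' hc.ne']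
  rw [this]
  ring

theorem klIntegrand_div {a b z : ℝ} (ha : 0 ≤ a) (hb : 0 ≤ b) (hz : 0 < z) (hz1 : z ≤ 1) :
    klIntegrand a (b / z) + ENNReal.ofReal a * ENNReal.ofReal (-Real.log z) + ENNReal.ofReal b =
      klIntegrand a b + ENNReal.ofReal (b / z) := by
  have hl : 0 ≤ -Real.log z := neg_nonneg.2 (Real.log_nonpos hz.le hz1)
  rcases ha.eq_or_lt with rfl | ha
  · rw [klIntegrand_zero_left hb, klIntegrand_zero_left (by positivity)]
    simp [add_comm]
  rcases hb.eq_or_lt with rfl | hb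
  · simp [klIntegrand_zero_right ha.ne']
  have hbz : 0 < b / z := by positivity
  have k1 := klIntegrand_real_nonneg ha.le hb
  have k2 := klIntegrand_real_nonneg ha.le hbz
  rw [klIntegrand_of_pos ha.le hb, klIntegrand_of_pos ha.le hbz, ← ENNReal.ofReal_mul ha.le,
    ← ENNReal.ofReal_add k2 (by positivity), ← ENNReal.ofReal_add (by positivity) hb.le,
    ← ENNReal.ofReal_add k1 hbz.le]
  congr 1
  rw [Real.log_div hb.ne' hz.ne']
  ring

end KLIntegrand

/-! ### The Rényi divergence as a real logarithm -/

section Renyi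

variable {Y : Type*} [MeasurableSpace Y] {w q : ProbabilityMeasure Y} {α : ℝ}

theorem affinity_ne_top (h0 : 0 < α) (h1 : α < 1) (w q : ProbabilityMeasure Y) :
    affinity α w q ≠ ⊤ :=
  ((affinity_le_one h0 h1 w q).trans_lt ENNReal.one_lt_top).ne

theorem renyiDiv_of_affinity_eq_zero (h0 : 0 < α) (h1 : α < 1) (h : affinity α w q = 0) :
    renyiDiv α w q = ⊤ := by
  have := coe_renyiDiv h0 h1 w q
  rw [renyiFormula, h, ENNReal.log_zero,
    EReal.coe_mul_bot_of_neg (inv_lt_zero.2 (by linarith))] at this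
  exact EReal.coe_ennreal_eq_top_iff.1 this

theorem renyiDiv_of_affinity_ne_zero (h0 : 0 < α) (h1 : α < 1) (h : affinity α w q ≠ 0) :
    renyiDiv α w q = ENNReal.ofReal (-Real.log (affinity α w q).toReal / (1 - α)) := by
  have e : ENNReal.log (affinity α w q) = ((Real.log (affinity α w q).toReal : ℝ) : EReal) :=
    ENNReal.log_pos_real h (affinity_ne_top h0 h1 w q)
  rw [renyiDiv, if_neg h1.ne, renyiFormula, e, ← EReal.coe_mul, EReal.toENNReal_of_ne_top
    (EReal.coe_ne_top _), EReal.toReal_coe]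
  congr 1
  have : 1 - α ≠ 0 := by linarith
  have : α - 1 ≠ 0 := by linarith
  field_simp
  ring

theorem log_affinity_nonpos (h0 : 0 < α) (h1 : α < 1) (w q : ProbabilityMeasure Y) :
    Real.log (affinity α w q).toReal ≤ 0 :=
  Real.log_nonpos ENNReal.toReal_nonneg
    (ENNReal.toReal_le_of_le_ofReal zero_le_one (by simpa using affinity_le_one h0 h1 w q))

end Renyi

/-! ### Strict gain at the midpoint of two output distributions -/

/-- The mean of two densities along which the Rényi divergence of order `α` is convex. -/
noncomputable def midMean (α a b : ℝ) : ℝ := if α = 1 then √(a * b) else powMean (1 - α) a b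

theorem midMean_nonneg {α a b : ℝ} (ha : 0 ≤ a) (hb : 0 ≤ b) : 0 ≤ midMean α a b := by
  unfold midMean
  split_ifs
  · exact Real.sqrt_nonneg _
  · exact powMean_nonneg ha hb

theorem midMean_add_le {α a b : ℝ} (h0 : 0 < α) (h1 : α ≤ 1) (ha : 0 ≤ a) (hb : 0 ≤ b) :
    midMean α a b + α / 4 * (√a - √b) ^ 2 ≤ (a + b) / 2 := by
  unfold midMean
  split_ifs with h
  · subst h
    rw [Real.sqrt_mul ha]
    nlinarith [Real.sq_sqrt ha, Real.sq_sqrt hb, sq_nonneg (√a - √b)]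
  · have := powMean_add_le (s := 1 - α) (by linarith [lt_of_le_of_ne h1 h]) (by linarith) ha hb
    linarith

section Midpoint

variable {Y : Type*} [MeasurableSpace Y] {ν : Measure Y} {f g₁ g₂ : Y → ℝ}
  {w q q₁ q₂ : ProbabilityMeasure Y} {α : ℝ}

theorem measurable_midMean (hg₁ : Measurable g₁) (hg₂ : Measurable g₂) :
    Measurable fun y => midMean α (g₁ y) (g₂ y) := by
  unfold midMean powMean
  split_ifs
  · exact (hg₁.mul hg₂).sqrt
  · exact (((hg₁.pow_const _).add (hg₂.pow_const _)).div_const 2).pow_const _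

theorem midMean_le {a b : ℝ} (h0 : 0 < α) (h1 : α ≤ 1) (ha : 0 ≤ a) (hb : 0 ≤ b) :
    midMean α a b ≤ (a + b) / 2 := by
  have := midMean_add_le h0 h1 ha hb
  have : 0 ≤ α / 4 * (√a - √b) ^ 2 := by positivity
  linarith

theorem integrable_midMean (h0 : 0 < α) (h1 : α ≤ 1) (hg₁ : IsDensity ν q₁ g₁)
    (hg₂ : IsDensity ν q₂ g₂) : Integrable (fun y => midMean α (g₁ y) (g₂ y)) ν := by
  refine ((hg₁.integrable.add hg₂.integrable).div_const 2).mono'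
    (measurable_midMean hg₁.measurable hg₂.measurable).aestronglyMeasurable
    (Eventually.of_forall fun y => ?_)
  rw [Real.norm_of_nonneg (midMean_nonneg (hg₁.nonneg y) (hg₂.nonneg y))]
  exact midMean_le h0 h1 (hg₁.nonneg y) (hg₂.nonneg y)

theorem integrable_sq_sqrt_sub (hg₁ : IsDensity ν q₁ g₁) (hg₂ : IsDensity ν q₂ g₂) :
    Integrable (fun y => (√(g₁ y) - √(g₂ y)) ^ 2) ν := by
  refine (hg₁.integrable.add hg₂.integrable).mono'
    ((hg₁.measurable.sqrt.sub hg₂.measurable.sqrt).pow_const 2).aestronglyMeasurable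
    (Eventually.of_forall fun y => ?_)
  rw [Real.norm_of_nonneg (sq_nonneg _), Pi.add_apply]
  nlinarith [Real.sq_sqrt (hg₁.nonneg y), Real.sq_sqrt (hg₂.nonneg y), Real.sqrt_nonneg (g₁ y),
    Real.sqrt_nonneg (g₂ y), mul_nonneg (Real.sqrt_nonneg (g₁ y)) (Real.sqrt_nonneg (g₂ y))]

/-- Cauchy-Schwarz applied to `|g₁ - g₂| = |√g₁ - √g₂| * (√g₁ + √g₂)`, in the form of a weighted
arithmetic-geometric inequality with a free parameter `t`. -/
theorem sq_tvDist_le (hg₁ : IsDensity ν q₁ g₁) (hg₂ : IsDensity ν q₂ g₂) :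
    tvDist q₁ q₂ ^ 2 ≤ 16 * ∫ y, (√(g₁ y) - √(g₂ y)) ^ 2 ∂ν := by
  have hd := integrable_sq_sqrt_sub hg₁ hg₂
  set H := ∫ y, (√(g₁ y) - √(g₂ y)) ^ 2 ∂ν
  have hH : 0 ≤ H := integral_nonneg fun y => sq_nonneg _
  have hL := tvDist_le_two_mul_integral hg₁ hg₂
  set T := ∫ y, |g₁ y - g₂ y| ∂ν with hT
  have hT0 : 0 ≤ T := integral_nonneg fun y => abs_nonneg _
  have key : ∀ t : ℝ, 0 ≤ t → 2 * t * T ≤ H + t ^ 2 * 4 := fun t ht => by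
    have hr : Integrable (fun y => t ^ 2 * (2 * (g₁ y + g₂ y))) ν :=
      ((hg₁.integrable.add hg₂.integrable).const_mul 2).const_mul _
    have h1 : ∫ y, 2 * t * |g₁ y - g₂ y| ∂ν ≤
        ∫ y, ((√(g₁ y) - √(g₂ y)) ^ 2 + t ^ 2 * (2 * (g₁ y + g₂ y))) ∂ν := by
      refine integral_mono ((hg₁.integrable.sub hg₂.integrable).abs.const_mul _) (hd.add hr) fun y => ?_
      have e1 := Real.sq_sqrt (hg₁.nonneg y)
      have e2 := Real.sq_sqrt (hg₂.nonneg y)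
      set a := √(g₁ y)
      set b := √(g₂ y)
      have ha : 0 ≤ a := Real.sqrt_nonneg _
      have hb : 0 ≤ b := Real.sqrt_nonneg _
      have : |g₁ y - g₂ y| = |a - b| * (a + b) := by
        rw [← e1, ← e2, sq_sub_sq, abs_mul, abs_of_nonneg (add_nonneg ha hb), mul_comm]
      change 2 * t * |g₁ y - g₂ y| ≤ (a - b) ^ 2 + t ^ 2 * (2 * (g₁ y + g₂ y))
      rw [this, ← e1, ← e2]
      have e3 : (a + b) ^ 2 ≤ 2 * (a ^ 2 + b ^ 2) := by nlinarith [sq_nonneg (a - b)]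
      have e4 := mul_le_mul_of_nonneg_left e3 (sq_nonneg t)
      nlinarith [sq_nonneg (|a - b| - t * (a + b)), sq_abs (a - b)]
    rw [integral_const_mul, integral_add hd hr, integral_const_mul,
      integral_const_mul, integral_add hg₁.integrable hg₂.integrable, hg₁.integral_eq_one,
      hg₂.integral_eq_one] at h1
    linarith
  -- The optimal parameter: it turns `key` into `T ^ 2 ≤ 4 * H`.
  have h2 := key (T / 4) (by positivity)
  have h3 := tvDist_nonneg q₁ q₂
  nlinarith

/-- The constant `α / 64` is `α / 4` from `midMean_add_le` times `1 / 16` from `sq_tvDist_le`. -/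
theorem integral_midMean_add_le (h0 : 0 < α) (h1 : α ≤ 1) (hg₁ : IsDensity ν q₁ g₁)
    (hg₂ : IsDensity ν q₂ g₂) :
    ∫ y, midMean α (g₁ y) (g₂ y) ∂ν + α / 64 * tvDist q₁ q₂ ^ 2 ≤ 1 := by
  have hd := integrable_sq_sqrt_sub hg₁ hg₂
  have hM := integrable_midMean h0 h1 hg₁ hg₂
  have h := integral_mono (hM.add (hd.const_mul (α / 4)))
    ((hg₁.integrable.add hg₂.integrable).div_const 2)
    fun y => midMean_add_le h0 h1 (hg₁.nonneg y) (hg₂.nonneg y)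
  rw [integral_add' hM (hd.const_mul _), integral_const_mul, integral_div,
    integral_add' hg₁.integrable hg₂.integrable, hg₁.integral_eq_one, hg₂.integral_eq_one] at h
  have := mul_le_mul_of_nonneg_left (sq_tvDist_le hg₁ hg₂) h0.le
  linarith

theorem two_mul_lintegral_klIntegrand_sqrt [SigmaFinite ν] (hf : IsDensity ν w f)
    (hg₁ : IsDensity ν q₁ g₁) (hg₂ : IsDensity ν q₂ g₂) :
    2 * ∫⁻ y, klIntegrand (f y) (√(g₁ y * g₂ y)) ∂ν + 2 =
      renyiDiv 1 w q₁ + renyiDiv 1 w q₂ + 2 * ∫⁻ y, ENNReal.ofReal (√(g₁ y * g₂ y)) ∂ν := by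
  have hm : Measurable fun y => √(g₁ y * g₂ y) := (hg₁.measurable.mul hg₂.measurable).sqrt
  have h := lintegral_congr (μ := ν) fun y =>
    two_mul_klIntegrand_sqrt (hf.nonneg y) (hg₁.nonneg y) (hg₂.nonneg y)
  have hs : Measurable fun y => ENNReal.ofReal (g₁ y) + ENNReal.ofReal (g₂ y) :=
    hg₁.measurable_ofReal.add hg₂.measurable_ofReal
  rw [lintegral_add_right _ hs,
    lintegral_const_mul _ (measurable_klIntegrand hf.measurable hm),
    lintegral_add_right _ hg₂.measurable_ofReal, hg₁.lintegral_eq, hg₂.lintegral_eq,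
    lintegral_add_right _ (hm.ennreal_ofReal.const_mul 2),
    lintegral_const_mul _ hm.ennreal_ofReal,
    lintegral_add_right _ (measurable_klIntegrand hf.measurable hg₂.measurable),
    ← klDiv_eq_lintegral hf hg₁, ← klDiv_eq_lintegral hf hg₂, measure_univ, measure_univ,
    one_add_one_eq_two] at h
  simpa [renyiDiv] using h

/-- Raising the power mean to the exponent `1 - α` gives the average of the powers, so only the
factor from the normalisation by `z` remains. -/
theorem affinity_powMean [SigmaFinite ν] (h0 : 0 < α) (h1 : α < 1) (hf : IsDensity ν w f)
    (hg₁ : IsDensity ν q₁ g₁) (hg₂ : IsDensity ν q₂ g₂) {z : ℝ} (hz : 0 < z)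
    (hq : IsDensity ν q fun y => powMean (1 - α) (g₁ y) (g₂ y) / z) :
    affinity α w q =
      ENNReal.ofReal (z ^ (-(1 - α)) / 2) * (affinity α w q₁ + affinity α w q₂) := by
  have hs : 0 < 1 - α := by linarith
  have hm : ∀ {g : Y → ℝ}, Measurable g →
      Measurable fun y => ENNReal.ofReal (f y ^ α * g y ^ (1 - α)) := fun hg =>
    ((hf.measurable.pow_const _).mul (hg.pow_const _)).ennreal_ofReal
  rw [affinity_eq_lintegral h0 h1 hf hq, affinity_eq_lintegral h0 h1 hf hg₁,
    affinity_eq_lintegral h0 h1 hf hg₂, ← lintegral_add_right _ (hm hg₂.measurable),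
    ← lintegral_const_mul' _ _ ENNReal.ofReal_ne_top]
  refine lintegral_congr fun y => ?_
  have hf0 := Real.rpow_nonneg (hf.nonneg y) α
  have h10 := Real.rpow_nonneg (hg₁.nonneg y) (1 - α)
  have h20 := Real.rpow_nonneg (hg₂.nonneg y) (1 - α)
  have hz0 := Real.rpow_nonneg hz.le (-(1 - α))
  rw [← ENNReal.ofReal_add (by positivity) (by positivity), ← ENNReal.ofReal_mul (by positivity),
    Real.div_rpow (powMean_nonneg (hg₁.nonneg y) (hg₂.nonneg y)) hz.le,
    powMean_rpow hs (hg₁.nonneg y) (hg₂.nonneg y), Real.rpow_neg hz.le]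
  congr 1
  field_simp

/-- This makes the normalisation possible. For `α = 1`, a vanishing geometric mean would make `q₁`
and `q₂` mutually singular, while `w` is absolutely continuous with respect to both. For `α < 1`, a
power mean vanishes only where both densities do. -/
theorem integral_midMean_pos [SigmaFinite ν] (h0 : 0 < α) (h1 : α ≤ 1) (hf : IsDensity ν w f)
    (hg₁ : IsDensity ν q₁ g₁) (hg₂ : IsDensity ν q₂ g₂) (h₁ : renyiDiv α w q₁ ≠ ⊤)
    (h₂ : renyiDiv α w q₂ ≠ ⊤) : 0 < ∫ y, midMean α (g₁ y) (g₂ y) ∂ν := by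
  have hnn : ∀ y, 0 ≤ midMean α (g₁ y) (g₂ y) := fun y =>
    midMean_nonneg (hg₁.nonneg y) (hg₂.nonneg y)
  refine lt_of_le_of_ne (integral_nonneg hnn) fun h => ?_
  have hae : ∀ᵐ y ∂ν, midMean α (g₁ y) (g₂ y) = 0 :=
    (integral_eq_zero_iff_of_nonneg hnn (integrable_midMean h0 h1 hg₁ hg₂)).1 h.symm
  rcases h1.eq_or_lt with rfl | h1
  · simp only [midMean, if_true] at hae
    have hk := two_mul_lintegral_klIntegrand_sqrt hf hg₁ hg₂
    have hne : ∫⁻ y, klIntegrand (f y) (√(g₁ y * g₂ y)) ∂ν ≠ ⊤ := fun ht => by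
      have hz : ∫⁻ y, ENNReal.ofReal (√(g₁ y * g₂ y)) ∂ν = 0 := by
        rw [lintegral_congr_ae (g := fun _ => 0) (by filter_upwards [hae] with y hy; simp [hy])]
        simp
      rw [ht, hz, ENNReal.mul_top (by norm_num), top_add, mul_zero, add_zero] at hk
      exact ENNReal.add_ne_top.2 ⟨h₁, h₂⟩ hk.symm
    have hf0 : ∀ᵐ y ∂ν, f y = 0 := by
      filter_upwards [hae, ae_lt_top (measurable_klIntegrand hf.measurable
        (hg₁.measurable.mul hg₂.measurable).sqrt) hne] with y hy hlt
      by_contra hfy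
      rw [Pi.mul_apply, hy, klIntegrand_zero_right hfy] at hlt
      exact lt_irrefl _ hlt
    have := hf.integral_eq_one
    rw [integral_congr_ae (g := fun _ => 0) hf0] at this
    simp at this
  · have hs : 0 < 1 - α := by linarith
    have hg0 : ∀ᵐ y ∂ν, g₁ y = 0 := by
      filter_upwards [hae] with y hy
      rw [midMean, if_neg h1.ne] at hy
      have := powMean_rpow hs (hg₁.nonneg y) (hg₂.nonneg y)
      rw [hy, Real.zero_rpow hs.ne'] at this
      have e1 := Real.rpow_nonneg (hg₁.nonneg y) (1 - α)
      have e2 := Real.rpow_nonneg (hg₂.nonneg y) (1 - α)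
      exact (Real.rpow_eq_zero (hg₁.nonneg y) hs.ne').1 (by linarith)
    have := hg₁.integral_eq_one
    rw [integral_congr_ae (g := fun _ => 0) hg0] at this
    simp at this

theorem two_mul_renyiDiv_midMean_add_le [SigmaFinite ν] (h0 : 0 < α) (h1 : α ≤ 1)
    (hf : IsDensity ν w f) (hg₁ : IsDensity ν q₁ g₁) (hg₂ : IsDensity ν q₂ g₂) {z : ℝ}
    (hz : z = ∫ y, midMean α (g₁ y) (g₂ y) ∂ν) (hz0 : 0 < z) (hz1 : z ≤ 1)
    (hq : IsDensity ν q fun y => midMean α (g₁ y) (g₂ y) / z) :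
    2 * (renyiDiv α w q + ENNReal.ofReal (1 - z)) ≤ renyiDiv α w q₁ + renyiDiv α w q₂ := by
  have hlog : 1 - z ≤ -Real.log z := by linarith [Real.log_le_sub_one_of_pos hz0]
  rcases h1.eq_or_lt with rfl | h1
  · have hi := integrable_midMean h0 h1 hg₁ hg₂
    have hnn : ∀ y, 0 ≤ midMean 1 (g₁ y) (g₂ y) := fun y =>
      midMean_nonneg (hg₁.nonneg y) (hg₂.nonneg y)
    have hzl : ∫⁻ y, ENNReal.ofReal (√(g₁ y * g₂ y)) ∂ν = ENNReal.ofReal z := by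
      have := ofReal_integral_eq_lintegral_ofReal hi (Eventually.of_forall hnn)
      rw [hz, this]
      simp [midMean]
    simp only [midMean, if_true] at hq
    have hm : Measurable fun y => √(g₁ y * g₂ y) := (hg₁.measurable.mul hg₂.measurable).sqrt
    have hk := two_mul_lintegral_klIntegrand_sqrt hf hg₁ hg₂
    have hd := lintegral_congr (μ := ν) fun y =>
      klIntegrand_div (hf.nonneg y) (Real.sqrt_nonneg (g₁ y * g₂ y)) hz0 hz1
    rw [lintegral_add_right _ hm.ennreal_ofReal,
      lintegral_add_right _ (hf.measurable_ofReal.mul_const _),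
      lintegral_mul_const _ hf.measurable_ofReal, hf.lintegral_eq,
      lintegral_add_right _ hq.measurable_ofReal, hq.lintegral_eq, hzl,
      ← klDiv_eq_lintegral hf hq, measure_univ, measure_univ, one_mul] at hd
    rw [hzl] at hk
    -- Adding the finite mass term makes `hk` and `hd` applicable without subtraction; what remains
    -- is `hlog`.
    rw [← ENNReal.add_le_add_iff_right (a := 2 * ENNReal.ofReal z)
      (ENNReal.mul_ne_top (by norm_num) ENNReal.ofReal_ne_top), ← hk, ← mul_add]
    have h2 : ∀ x : ℝ≥0∞, 2 * x + 2 = 2 * (x + 1) := fun x => by ring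
    rw [h2, ← hd]
    simp only [renyiDiv, if_true]
    gcongr
  · simp only [midMean, if_neg h1.ne] at hq
    have hs : 0 < 1 - α := by linarith
    by_cases e1 : affinity α w q₁ = 0
    · rw [renyiDiv_of_affinity_eq_zero h0 h1 e1, top_add]; exact le_top
    by_cases e2 : affinity α w q₂ = 0
    · rw [renyiDiv_of_affinity_eq_zero h0 h1 e2, add_top]; exact le_top
    have hA := affinity_powMean h0 h1 hf hg₁ hg₂ hz0 hq
    have t1 := affinity_ne_top h0 h1 w q₁
    have t2 := affinity_ne_top h0 h1 w q₂
    have p1 := ENNReal.toReal_pos e1 t1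
    have p2 := ENNReal.toReal_pos e2 t2
    have l1 := log_affinity_nonpos h0 h1 w q₁
    have l2 := log_affinity_nonpos h0 h1 w q₂
    have l3 := log_affinity_nonpos h0 h1 w q
    have hzp := Real.rpow_pos_of_pos hz0 (-(1 - α))
    have hAr : (affinity α w q).toReal = z ^ (-(1 - α)) *
        (((affinity α w q₁).toReal + (affinity α w q₂).toReal) / 2) := by
      rw [hA, ENNReal.toReal_mul, ENNReal.toReal_ofReal (by positivity),
        ENNReal.toReal_add t1 t2]
      ring
    have e3 : affinity α w q ≠ 0 := fun h => by
      rw [h, ENNReal.toReal_zero] at hAr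
      have : 0 < z ^ (-(1 - α)) *
        (((affinity α w q₁).toReal + (affinity α w q₂).toReal) / 2) := by positivity
      linarith
    rw [renyiDiv_of_affinity_ne_zero h0 h1 e1, renyiDiv_of_affinity_ne_zero h0 h1 e2,
      renyiDiv_of_affinity_ne_zero h0 h1 e3,
      ← ENNReal.ofReal_add (div_nonneg (by linarith) hs.le) (by linarith),
      ← ENNReal.ofReal_add (div_nonneg (by linarith) hs.le) (div_nonneg (by linarith) hs.le),
      show (2 : ℝ≥0∞) = ENNReal.ofReal 2 by simp, ← ENNReal.ofReal_mul (by norm_num)]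
    refine ENNReal.ofReal_le_ofReal ?_
    rw [hAr, Real.log_mul hzp.ne' (by positivity), Real.log_rpow hz0]
    set a := (affinity α w q₁).toReal
    set b := (affinity α w q₂).toReal
    -- Concavity of the logarithm, as the inequality between geometric and arithmetic means.
    have hab : (Real.log a + Real.log b) / 2 ≤ Real.log ((a + b) / 2) := by
      have : Real.log (a * b) ≤ Real.log (((a + b) / 2) ^ 2) :=
        Real.log_le_log (by positivity) (by nlinarith [sq_nonneg (a - b)])
      rw [Real.log_mul p1.ne' p2.ne', Real.log_pow] at this
      push_cast at this
      linarith
    have e4 : -(-(1 - α) * Real.log z + Real.log ((a + b) / 2)) / (1 - α) =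
        Real.log z - Real.log ((a + b) / 2) / (1 - α) := by
      field_simp
      ring
    have e5 := div_le_div_of_nonneg_right hab hs.le
    have e6 : (Real.log a + Real.log b) / 2 / (1 - α) * 2 =
      -(-Real.log a / (1 - α) + -Real.log b / (1 - α)) := by ring
    rw [e4]
    linarith

end Midpoint

/-! ### Completeness of total variation and lower semicontinuity of the divergence -/

section Topological

variable {Y : Type*} [MeasurableSpace Y] {α : ℝ}

theorem exists_common_density {ι : Type*} [Countable ι] (m : ι → ProbabilityMeasure Y) :
    ∃ ν : Measure Y, IsFiniteMeasure ν ∧ ∃ g : ι → Y → ℝ, ∀ i, IsDensity ν (m i) (g i) := by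
  let μ : Measure Y := Measure.sum fun i => (m i : Measure Y)
  have h : ∀ i, (m i : Measure Y) ≪ μ.toFinite := fun i =>
    (Measure.absolutelyContinuous_sum_right i Measure.AbsolutelyContinuous.rfl).trans
      (absolutelyContinuous_toFinite μ)
  choose g hg using fun i => exists_isDensity (h i)
  exact ⟨μ.toFinite, inferInstance, g, hg⟩

theorem exists_tendsto_tvDist {m : ℕ → ProbabilityMeasure Y} (hm : IsCauchyTV m) :
    ∃ q, Tendsto (fun n => tvDist (m n) q) atTop (𝓝 0) := by
  obtain ⟨ν, hν, g, hg⟩ := exists_common_density m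
  let F : ℕ → Lp ℝ 1 ν := fun n => (hg n).integrable.toL1 (g n)
  have hdist : ∀ {u v : Y → ℝ} (hu : Integrable u ν) (hv : Integrable v ν),
      dist (hu.toL1 u) (hv.toL1 v) = ∫ y, |u y - v y| ∂ν := fun hu hv => by
    rw [dist_eq_norm, ← Integrable.toL1_sub, L1.norm_of_fun_eq_integral_norm]
    rfl
  have hF : CauchySeq F := by
    refine Metric.cauchySeq_iff.2 fun ε hε => ?_
    obtain ⟨N, hN⟩ := hm ε hε
    refine ⟨N, fun i hi j hj => ?_⟩
    rw [hdist]
    exact (integral_abs_sub_le_tvDist (hg i) (hg j)).trans_lt (hN i hi j hj)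
  obtain ⟨G, hG⟩ := cauchySeq_tendsto_of_complete hF
  have hGi : Integrable G ν := L1.integrable_coeFn G
  have hGd : Tendsto (fun n => ∫ y, |g n y - G y| ∂ν) atTop (𝓝 0) := by
    have h := tendsto_iff_dist_tendsto_zero.1 hG
    refine h.congr fun n => ?_
    conv_lhs => rw [← Integrable.toL1_coeFn G hGi]
    exact hdist (hg n).integrable hGi
  -- The limit class in `L¹` has no pointwise sign; its positive part is no farther from the
  -- nonnegative `g n`.
  let k : Y → ℝ := fun y => max (G y) 0
  have hk : Measurable k := (Lp.stronglyMeasurable G).measurable.max measurable_const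
  have hki : Integrable k ν := hGi.pos_part
  have hkd : Tendsto (fun n => ∫ y, |g n y - k y| ∂ν) atTop (𝓝 0) := by
    refine squeeze_zero (fun n => integral_nonneg fun y => abs_nonneg _) (fun n => ?_) hGd
    refine integral_mono ((hg n).integrable.sub hki).abs ((hg n).integrable.sub hGi).abs
      fun y => ?_
    have h := abs_max_sub_max_le_abs (g n y) (G y) 0
    rwa [max_eq_left ((hg n).nonneg y)] at h
  have hk1 : ∫ y, k y ∂ν = 1 := by
    have h : ∀ n, |1 - ∫ y, k y ∂ν| ≤ ∫ y, |g n y - k y| ∂ν := fun n => by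
      rw [← (hg n).integral_eq_one, ← integral_sub (hg n).integrable hki]
      exact abs_integral_le_integral_abs
    have h0 := ge_of_tendsto' hkd h
    linarith [abs_eq_zero.1 (le_antisymm h0 (abs_nonneg _))]
  obtain ⟨q, hq⟩ := exists_probabilityMeasure_isDensity hk (fun y => le_max_right _ _) hki hk1
  refine ⟨q, squeeze_zero (fun n => tvDist_nonneg _ _)
    (fun n => tvDist_le_two_mul_integral (hg n) hq) ?_⟩
  simpa using hkd.const_mul 2

/-- Subadditivity of `t ↦ t ^ (1 - α)` followed by Hölder's inequality. -/
theorem affinity_le_add (h0 : 0 < α) (h1 : α < 1) (w q q' : ProbabilityMeasure Y) :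
    affinity α w q ≤ affinity α w q' + ENNReal.ofReal (tvDist q q') ^ (1 - α) := by
  obtain ⟨ν, hν, g, hg⟩ := exists_common_density ![w, q, q']
  have hw : IsDensity ν w (g 0) := hg 0
  have hq : IsDensity ν q (g 1) := hg 1
  have hq' : IsDensity ν q' (g 2) := hg 2
  have hs : 0 < 1 - α := by linarith
  have hm : ∀ {g' : Y → ℝ}, Measurable g' →
      Measurable fun y => ENNReal.ofReal (g 0 y ^ α * g' y ^ (1 - α)) := fun hg' =>
    ((hw.measurable.pow_const _).mul (hg'.pow_const _)).ennreal_ofReal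
  have hd : Measurable fun y => |g 1 y - g 2 y| := (hq.measurable.sub hq'.measurable).abs
  have hdi : Integrable (fun y => |g 1 y - g 2 y|) ν := (hq.integrable.sub hq'.integrable).abs
  have key : ∀ y, ENNReal.ofReal (g 0 y ^ α * g 1 y ^ (1 - α)) ≤
      ENNReal.ofReal (g 0 y ^ α * g 2 y ^ (1 - α)) +
        ENNReal.ofReal (g 0 y) ^ α * ENNReal.ofReal |g 1 y - g 2 y| ^ (1 - α) := fun y => by
    have ha := Real.rpow_nonneg (hw.nonneg y) α
    have hb := Real.rpow_nonneg (hq'.nonneg y) (1 - α)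
    have hc := Real.rpow_nonneg (abs_nonneg (g 1 y - g 2 y)) (1 - α)
    rw [ENNReal.ofReal_rpow_of_nonneg (hw.nonneg y) h0.le,
      ENNReal.ofReal_rpow_of_nonneg (abs_nonneg _) hs.le, ← ENNReal.ofReal_mul ha,
      ← ENNReal.ofReal_add (by positivity) (by positivity), ← mul_add]
    refine ENNReal.ofReal_le_ofReal (mul_le_mul_of_nonneg_left ?_ ha)
    calc g 1 y ^ (1 - α) ≤ (g 2 y + |g 1 y - g 2 y|) ^ (1 - α) :=
          Real.rpow_le_rpow (hq.nonneg y) (by linarith [le_abs_self (g 1 y - g 2 y)]) hs.le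
      _ ≤ _ := Real.rpow_add_le_add_rpow (hq'.nonneg y) (abs_nonneg _) hs.le (by linarith)
  rw [affinity_eq_lintegral h0 h1 hw hq, affinity_eq_lintegral h0 h1 hw hq']
  refine (lintegral_mono key).trans ?_
  rw [lintegral_add_left (hm hq'.measurable)]
  gcongr
  refine (ENNReal.lintegral_mul_norm_pow_le hw.measurable_ofReal.aemeasurable
    hd.ennreal_ofReal.aemeasurable h0.le hs.le (by ring)).trans ?_
  rw [hw.lintegral_eq, measure_univ, ENNReal.one_rpow, one_mul,
    ← ofReal_integral_eq_lintegral_ofReal hdi (Eventually.of_forall fun y => abs_nonneg _)]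
  exact ENNReal.rpow_le_rpow
    (ENNReal.ofReal_le_ofReal (integral_abs_sub_le_tvDist hq hq')) hs.le

theorem tendsto_affinity (h0 : 0 < α) (h1 : α < 1) (w : ProbabilityMeasure Y)
    {q : ProbabilityMeasure Y} {m : ℕ → ProbabilityMeasure Y}
    (hm : Tendsto (fun n => tvDist (m n) q) atTop (𝓝 0)) :
    Tendsto (fun n => affinity α w (m n)) atTop (𝓝 (affinity α w q)) := by
  have hs : 0 < 1 - α := by linarith
  have hpow : Tendsto (fun n => ENNReal.ofReal (tvDist (m n) q) ^ (1 - α)) atTop (𝓝 0) := by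
    have h := (ENNReal.continuous_rpow_const (y := 1 - α)).tendsto (ENNReal.ofReal 0)
    have h' := h.comp (ENNReal.tendsto_ofReal hm)
    simpa [ENNReal.zero_rpow_of_pos hs, Function.comp_def] using h'
  have hadd := hpow.const_add (affinity α w q)
  have hsub := ENNReal.Tendsto.sub (tendsto_const_nhds (x := affinity α w q)) hpow
    (Or.inr ENNReal.zero_ne_top)
  rw [add_zero] at hadd
  rw [tsub_zero] at hsub
  refine tendsto_of_tendsto_of_tendsto_of_le_of_le hsub hadd (fun n => ?_) fun n => ?_
  · have := affinity_le_add h0 h1 w q (m n)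
    rw [tvDist_comm] at this
    exact tsub_le_iff_right.2 this
  · exact affinity_le_add h0 h1 w (m n) q

theorem tendsto_renyiDiv (h0 : 0 < α) (h1 : α < 1) (w : ProbabilityMeasure Y)
    {q : ProbabilityMeasure Y} {m : ℕ → ProbabilityMeasure Y}
    (hm : Tendsto (fun n => tvDist (m n) q) atTop (𝓝 0)) :
    Tendsto (fun n => renyiDiv α w (m n)) atTop (𝓝 (renyiDiv α w q)) := by
  rw [← EReal.tendsto_coe_ennreal]
  simp only [coe_renyiDiv h0 h1, renyiFormula]
  exact EReal.Tendsto.const_mul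
    ((ENNReal.continuous_log.tendsto _).comp (tendsto_affinity h0 h1 w hm))
    (Or.inl (EReal.coe_ne_bot _)) (Or.inl (EReal.coe_ne_top _))

theorem klIntegrand_le_liminf {a b : ℝ} (ha : 0 ≤ a) (hb : 0 ≤ b) {u : ℕ → ℝ}
    (hu0 : ∀ n, 0 ≤ u n) (hu : Tendsto u atTop (𝓝 b)) :
    klIntegrand a b ≤ liminf (fun n => klIntegrand a (u n)) atTop := by
  rcases hb.eq_or_lt with rfl | hb
  · rcases ha.eq_or_lt with rfl | ha
    · simp [klIntegrand]
    refine ENNReal.le_of_forall_nnreal_lt fun r _ => le_liminf_of_le (by isBoundedDefault) ?_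
    -- Below this exponential threshold the term `-a * log (u n)` alone pushes the integrand above
    -- `r`.
    filter_upwards [hu.eventually (gt_mem_nhds
      (Real.exp_pos ((a * Real.log a - a - r) / a)))] with n hn
    rcases (hu0 n).eq_or_lt with h | h
    · rw [← h, klIntegrand_zero_right ha.ne']; exact le_top
    · rw [klIntegrand_of_pos ha.le h, ← ENNReal.ofReal_coe_nnreal]
      refine ENNReal.ofReal_le_ofReal ?_
      have h2 := mul_le_mul_of_nonneg_left ((Real.log_lt_iff_lt_exp h).2 hn).le ha.le
      rw [mul_div_cancel₀ _ ha.ne'] at h2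
      linarith
  · refine le_of_eq (Tendsto.liminf_eq ?_).symm
    rw [klIntegrand_of_pos ha hb]
    have h1 : Tendsto (fun n => ENNReal.ofReal
        (a * Real.log a - a * Real.log (u n) + u n - a)) atTop
        (𝓝 (ENNReal.ofReal (a * Real.log a - a * Real.log b + b - a))) :=
      ENNReal.tendsto_ofReal ((((hu.log hb.ne').const_mul a).const_sub _).add hu |>.sub_const a)
    refine h1.congr' ?_
    filter_upwards [hu.eventually (lt_mem_nhds hb)] with n hn
    rw [klIntegrand_of_pos ha hn]

theorem renyiDiv_one_le_liminf (w : ProbabilityMeasure Y) {q : ProbabilityMeasure Y}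
    {m : ℕ → ProbabilityMeasure Y} (hm : Tendsto (fun n => tvDist (m n) q) atTop (𝓝 0)) :
    renyiDiv 1 w q ≤ liminf (fun n => renyiDiv 1 w (m n)) atTop := by
  by_contra! hlt
  obtain ⟨c, hc1, hc2⟩ := exists_between hlt
  -- The values must first be held below `c`: the almost everywhere convergent subsequence chosen
  -- later could otherwise have a larger lower limit than `m`.
  obtain ⟨φ, hφ, hφc⟩ :=
    extraction_of_frequently_atTop (frequently_lt_of_liminf_lt (by isBoundedDefault) hc1)
  obtain ⟨ν, hν, g, hg⟩ := exists_common_density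
    (Sum.elim (fun n => m (φ n)) (fun b : Bool => if b then w else q))
  have hw : IsDensity ν w (g (Sum.inr true)) := hg (Sum.inr true)
  have hq : IsDensity ν q (g (Sum.inr false)) := hg (Sum.inr false)
  have hn : ∀ n, IsDensity ν (m (φ n)) (g (Sum.inl n)) := fun n => hg (Sum.inl n)
  generalize g (Sum.inr true) = f at hw
  generalize g (Sum.inr false) = k at hq
  have hmeas : TendstoInMeasure ν (fun n => g (Sum.inl n)) atTop k := by
    refine tendstoInMeasure_of_tendsto_eLpNorm one_ne_zero
      (fun n => (hn n).measurable.aestronglyMeasurable) hq.measurable.aestronglyMeasurable ?_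
    have h1 : Tendsto (fun n => ENNReal.ofReal (tvDist (m (φ n)) q)) atTop (𝓝 0) := by
      simpa using ENNReal.tendsto_ofReal (hm.comp hφ.tendsto_atTop)
    refine tendsto_of_tendsto_of_tendsto_of_le_of_le tendsto_const_nhds h1
      (fun n => bot_le) fun n => ?_
    have hi : Integrable (fun y => g (Sum.inl n) y - k y) ν := (hn n).integrable.sub hq.integrable
    have h2 : eLpNorm (g (Sum.inl n) - k) 1 ν =
        ENNReal.ofReal (∫ y, |g (Sum.inl n) y - k y| ∂ν) := by
      rw [eLpNorm_one_eq_lintegral_enorm, ofReal_integral_eq_lintegral_ofReal hi.abs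
        (Eventually.of_forall fun y => abs_nonneg _)]
      exact lintegral_congr fun y => Real.enorm_eq_ofReal_abs _
    rw [h2]
    exact ENNReal.ofReal_le_ofReal (integral_abs_sub_le_tvDist (hn n) hq)
  obtain ⟨ns, -, hae⟩ := hmeas.exists_seq_tendsto_ae
  have h1 : renyiDiv 1 w q ≤ liminf (fun i => renyiDiv 1 w (m (φ (ns i)))) atTop := by
    simp only [renyiDiv, if_true]
    rw [klDiv_eq_lintegral hw hq]
    simp only [fun i => klDiv_eq_lintegral hw (hn (ns i))]
    refine le_trans (lintegral_mono_ae ?_)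
      (lintegral_liminf_le fun i => measurable_klIntegrand hw.measurable (hn (ns i)).measurable)
    filter_upwards [hae] with y hy
    exact klIntegrand_le_liminf (hw.nonneg y) (hq.nonneg y) (fun i => (hn (ns i)).nonneg y) hy
  have h2 : liminf (fun i => renyiDiv 1 w (m (φ (ns i)))) atTop ≤ c :=
    liminf_le_of_frequently_le' (Eventually.of_forall fun i => (hφc (ns i)).le).frequently
  exact absurd (h1.trans h2) (not_le.2 hc2)

theorem renyiDiv_le_liminf (h0 : 0 < α) (h1 : α ≤ 1) (w : ProbabilityMeasure Y)
    {q : ProbabilityMeasure Y} {m : ℕ → ProbabilityMeasure Y}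
    (hm : Tendsto (fun n => tvDist (m n) q) atTop (𝓝 0)) :
    renyiDiv α w q ≤ liminf (fun n => renyiDiv α w (m n)) atTop := by
  rcases h1.eq_or_lt with rfl | h1
  · exact renyiDiv_one_le_liminf w hm
  · exact (tendsto_renyiDiv h0 h1 w hm).liminf_eq.ge

variable {X : Type*} {W : X → ProbabilityMeasure Y} {p : X →₀ ℝ}

theorem condRenyiDiv_le_liminf (h0 : 0 < α) (h1 : α ≤ 1) {q : ProbabilityMeasure Y}
    {m : ℕ → ProbabilityMeasure Y} (hm : Tendsto (fun n => tvDist (m n) q) atTop (𝓝 0)) :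
    condRenyiDiv α W q p ≤ liminf (fun n => condRenyiDiv α W (m n) p) atTop := by
  -- As an integral against counting measure, the finite sum falls under Fatou's lemma.
  let _ : MeasurableSpace X := ⊤
  have hsum : ∀ u : X → ℝ≥0∞, ∑ x ∈ p.support, u x = ∫⁻ x in p.support, u x ∂Measure.count :=
    fun u => by simp [lintegral_finset]
  simp only [condRenyiDiv, hsum]
  refine le_trans (lintegral_mono fun x => ?_)
    (lintegral_liminf_le fun n => measurable_from_top)
  rw [ENNReal.liminf_const_mul_of_ne_top ENNReal.ofReal_ne_top]
  gcongr
  exact renyiDiv_le_liminf h0 h1 (W x) hm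

theorem condRenyiDiv_le_of_tendsto (h0 : 0 < α) (h1 : α ≤ 1) {q : ProbabilityMeasure Y}
    {m : ℕ → ProbabilityMeasure Y} (hm : Tendsto (fun n => tvDist (m n) q) atTop (𝓝 0))
    {u : ℕ → ℝ≥0∞} {c : ℝ≥0∞} (hu : Tendsto u atTop (𝓝 c))
    (hle : ∀ n, condRenyiDiv α W (m n) p ≤ u n) : condRenyiDiv α W q p ≤ c := by
  rw [← hu.liminf_eq]
  exact (condRenyiDiv_le_liminf h0 h1 hm).trans (liminf_le_liminf (Eventually.of_forall hle))

end Topological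

/-! ### Finite information, uniform convexity in `q`, linearity in `p` -/

section Prior

variable {X Y : Type*} [MeasurableSpace Y] {α : ℝ} {W : X → ProbabilityMeasure Y} {p : X →₀ ℝ}

/-- Intended for the output mixture `∑ x, p x * W x`, whose density dominates `p x` times that of
each `W x`; this keeps the information finite. -/
theorem renyiDiv_ne_top_of_mul_le {ν : Measure Y} [SigmaFinite ν] {w q : ProbabilityMeasure Y}
    {f g : Y → ℝ} (h0 : 0 < α) (h1 : α ≤ 1) (hf : IsDensity ν w f) (hg : IsDensity ν q g) {c : ℝ}
    (hc : 0 < c) (hfg : ∀ y, c * f y ≤ g y) : renyiDiv α w q ≠ ⊤ := by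
  rcases h1.eq_or_lt with rfl | h1
  · rw [renyiDiv, if_pos rfl, klDiv_eq_lintegral hf hg]
    have hle : ∀ y, klIntegrand (f y) (g y) ≤
        ENNReal.ofReal (f y) * ENNReal.ofReal |Real.log c| + ENNReal.ofReal (g y) := fun y => by
      rcases (hf.nonneg y).eq_or_lt with h | h
      · rw [← h, klIntegrand_zero_left (hg.nonneg y)]; simp
      · have hcf : 0 < c * f y := mul_pos hc h
        rw [klIntegrand_of_pos h.le (hcf.trans_le (hfg y)), ← ENNReal.ofReal_mul h.le,
          ← ENNReal.ofReal_add (by positivity) (hg.nonneg y)]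
        refine ENNReal.ofReal_le_ofReal ?_
        have h2 := Real.log_le_log hcf (hfg y)
        rw [Real.log_mul hc.ne' h.ne'] at h2
        have h3 := mul_le_mul_of_nonneg_left h2 h.le
        have h4 := mul_le_mul_of_nonneg_left (neg_abs_le (Real.log c)) h.le
        linarith
    refine ((lintegral_mono hle).trans_lt ?_).ne
    rw [lintegral_add_right _ hg.measurable_ofReal, lintegral_mul_const _ hf.measurable_ofReal,
      hf.lintegral_eq, hg.lintegral_eq, measure_univ, measure_univ, one_mul]
    exact ENNReal.add_lt_top.2 ⟨ENNReal.ofReal_lt_top, ENNReal.one_lt_top⟩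
  · have hs : 0 < 1 - α := by linarith
    have hle : ∀ y, ENNReal.ofReal (c ^ (1 - α)) * ENNReal.ofReal (f y) ≤
        ENNReal.ofReal (f y ^ α * g y ^ (1 - α)) := fun y => by
      rw [← ENNReal.ofReal_mul (Real.rpow_nonneg hc.le _)]
      refine ENNReal.ofReal_le_ofReal ?_
      have h2 := Real.rpow_le_rpow (mul_nonneg hc.le (hf.nonneg y)) (hfg y) hs.le
      rw [Real.mul_rpow hc.le (hf.nonneg y)] at h2
      have h3 : f y = f y ^ α * f y ^ (1 - α) := by
        rw [← Real.rpow_add_of_nonneg (hf.nonneg y) h0.le hs.le]; simp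
      calc c ^ (1 - α) * f y = f y ^ α * (c ^ (1 - α) * f y ^ (1 - α)) := by
            conv_lhs => rw [h3]
            ring
        _ ≤ _ := mul_le_mul_of_nonneg_left h2 (Real.rpow_nonneg (hf.nonneg y) _)
    have hA : affinity α w q ≠ 0 := by
      rw [affinity_eq_lintegral h0 h1 hf hg]
      refine (lt_of_lt_of_le ?_ (lintegral_mono hle)).ne'
      rw [lintegral_const_mul _ hf.measurable_ofReal, hf.lintegral_eq, measure_univ, mul_one]
      exact ENNReal.ofReal_pos.2 (Real.rpow_pos_of_pos hc _)
    rw [renyiDiv_of_affinity_ne_zero h0 h1 hA]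
    exact ENNReal.ofReal_ne_top

theorem pos_of_mem_support (hp : p ∈ priors X) {x : X} (hx : x ∈ p.support) : 0 < p x :=
  lt_of_le_of_ne (hp.1 x) (Finsupp.mem_support_iff.1 hx).symm

theorem sum_ofReal_eq_one (hp : p ∈ priors X) : ∑ x ∈ p.support, ENNReal.ofReal (p x) = 1 := by
  rw [← ENNReal.ofReal_sum_of_nonneg fun x _ => hp.1 x, hp.2, ENNReal.ofReal_one]

theorem information_le (q : ProbabilityMeasure Y) :
    information α W p ≤ condRenyiDiv α W q p := iInf_le _ q

theorem information_ne_top (h0 : 0 < α) (h1 : α ≤ 1) (hp : p ∈ priors X) :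
    information α W p ≠ ⊤ := by
  obtain ⟨ν, hν, f, hf⟩ := exists_common_density fun x : p.support => W x
  have hnn : ∀ (x : p.support) y, 0 ≤ p x * f x y := fun x y =>
    mul_nonneg (hp.1 x) ((hf x).nonneg y)
  have hgi : Integrable (fun y => ∑ x : p.support, p x * f x y) ν :=
    integrable_finsetSum _ fun x _ => (hf x).integrable.const_mul _
  obtain ⟨q, hq⟩ := exists_probabilityMeasure_isDensity
    (ν := ν) (g := fun y => ∑ x : p.support, p x * f x y)
    (Finset.measurable_fun_sum _ fun x _ => (hf x).measurable.const_mul _)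
    (fun y => Finset.sum_nonneg fun x _ => hnn x y) hgi (by
      rw [integral_finsetSum _ fun x _ => (hf x).integrable.const_mul _]
      simp only [integral_const_mul, (hf _).integral_eq_one, mul_one]
      rw [← hp.2]
      exact Finset.sum_coe_sort p.support fun x => p x)
  refine ((information_le q).trans_lt ?_).ne
  refine ENNReal.sum_lt_top.2 fun x hx => ENNReal.mul_lt_top ENNReal.ofReal_lt_top ?_
  exact (renyiDiv_ne_top_of_mul_le h0 h1 (hf ⟨x, hx⟩) hq (pos_of_mem_support hp hx) fun y =>
    Finset.single_le_sum (f := fun x : p.support => p x * f x y) (fun x _ => hnn x y)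
      (Finset.mem_univ ⟨x, hx⟩)).lt_top

/-- The conditional Rényi divergence is strongly convex, up to its infimum. -/
theorem two_mul_information_add_le (h0 : 0 < α) (h1 : α ≤ 1) (hp : p ∈ priors X)
    (q₁ q₂ : ProbabilityMeasure Y) :
    2 * (information α W p + ENNReal.ofReal (α / 64 * tvDist q₁ q₂ ^ 2)) ≤
      condRenyiDiv α W q₁ p + condRenyiDiv α W q₂ p := by
  by_cases h₁ : condRenyiDiv α W q₁ p = ⊤
  · rw [h₁, top_add]; exact le_top
  by_cases h₂ : condRenyiDiv α W q₂ p = ⊤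
  · rw [h₂, add_top]; exact le_top
  obtain ⟨ν, hν, g, hg⟩ := exists_common_density
    (Sum.elim (fun x : p.support => W x) (fun b : Bool => if b then q₁ else q₂))
  have hW : ∀ x : p.support, IsDensity ν (W x) (g (Sum.inl x)) := fun x => hg (Sum.inl x)
  have hg₁ : IsDensity ν q₁ (g (Sum.inr true)) := hg (Sum.inr true)
  have hg₂ : IsDensity ν q₂ (g (Sum.inr false)) := hg (Sum.inr false)
  generalize g (Sum.inr true) = g₁ at hg₁
  generalize g (Sum.inr false) = g₂ at hg₂
  obtain ⟨x, hx⟩ : p.support.Nonempty := by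
    rw [Finset.nonempty_iff_ne_empty]
    intro h
    have := hp.2
    rw [h, Finset.sum_empty] at this
    exact zero_ne_one this
  have hfin : ∀ q, condRenyiDiv α W q p ≠ ⊤ → renyiDiv α (W x) q ≠ ⊤ := fun q hq ht => by
    have h := ENNReal.sum_ne_top.1 hq x hx
    rw [ht, ENNReal.mul_top (ENNReal.ofReal_pos.2 (pos_of_mem_support hp hx)).ne'] at h
    exact h rfl
  obtain ⟨z, hz⟩ : ∃ z, z = ∫ y, midMean α (g₁ y) (g₂ y) ∂ν := ⟨_, rfl⟩
  have hz0 : 0 < z := hz ▸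
    integral_midMean_pos h0 h1 (hW ⟨x, hx⟩) hg₁ hg₂ (hfin q₁ h₁) (hfin q₂ h₂)
  have hz1 := integral_midMean_add_le h0 h1 hg₁ hg₂
  rw [← hz] at hz1
  have hnn : 0 ≤ α / 64 * tvDist q₁ q₂ ^ 2 := by positivity
  obtain ⟨q, hq⟩ := exists_probabilityMeasure_isDensity
    (ν := ν) (g := fun y => midMean α (g₁ y) (g₂ y) / z)
    ((measurable_midMean hg₁.measurable hg₂.measurable).div_const _)
    (fun y => div_nonneg (midMean_nonneg (hg₁.nonneg y) (hg₂.nonneg y)) hz0.le)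
    ((integrable_midMean h0 h1 hg₁ hg₂).div_const _)
    (by rw [integral_div, ← hz, div_self hz0.ne'])
  -- One midpoint `q` serves all `x` with the same gain `1 - z`, and the weights `p x` sum to one.
  calc 2 * (information α W p + ENNReal.ofReal (α / 64 * tvDist q₁ q₂ ^ 2))
      ≤ 2 * (condRenyiDiv α W q p + ENNReal.ofReal (1 - z)) := by
        gcongr
        · exact information_le q
        · linarith
    _ = ∑ x ∈ p.support, ENNReal.ofReal (p x) *
          (2 * (renyiDiv α (W x) q + ENNReal.ofReal (1 - z))) := by
        simp only [mul_add, Finset.sum_add_distrib]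
        rw [← Finset.sum_mul, sum_ofReal_eq_one hp, one_mul, condRenyiDiv, Finset.mul_sum]
        simp only [mul_left_comm]
    _ ≤ ∑ x ∈ p.support, ENNReal.ofReal (p x) *
          (renyiDiv α (W x) q₁ + renyiDiv α (W x) q₂) := by
        refine Finset.sum_le_sum fun x hx => ?_
        gcongr
        exact two_mul_renyiDiv_midMean_add_le h0 h1 (hW ⟨x, hx⟩) hg₁ hg₂ hz hz0
          (by linarith) hq
    _ = condRenyiDiv α W q₁ p + condRenyiDiv α W q₂ p := by
        simp only [mul_add, Finset.sum_add_distrib, condRenyiDiv]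

theorem condRenyiDiv_eq_sum {s : Finset X} (hs : p.support ⊆ s) (q : ProbabilityMeasure Y) :
    condRenyiDiv α W q p = ∑ x ∈ s, ENNReal.ofReal (p x) * renyiDiv α (W x) q := by
  refine Finset.sum_subset hs fun x _ hx => ?_
  rw [Finsupp.notMem_support_iff.1 hx]
  simp

theorem condRenyiDiv_combination {p₁ p₂ : X →₀ ℝ} (hp₁ : p₁ ∈ priors X) (hp₂ : p₂ ∈ priors X)
    {a b : ℝ} (ha : 0 ≤ a) (hb : 0 ≤ b) (q : ProbabilityMeasure Y) :
    condRenyiDiv α W q (a • p₁ + b • p₂) =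
      ENNReal.ofReal a * condRenyiDiv α W q p₁ + ENNReal.ofReal b * condRenyiDiv α W q p₂ := by
  classical
  rw [condRenyiDiv_eq_sum (p := a • p₁ + b • p₂) (s := p₁.support ∪ p₂.support)
      (Finsupp.support_add.trans
        (Finset.union_subset_union Finsupp.support_smul Finsupp.support_smul)),
    condRenyiDiv_eq_sum (p := p₁) Finset.subset_union_left,
    condRenyiDiv_eq_sum (p := p₂) Finset.subset_union_right, Finset.mul_sum, Finset.mul_sum,
    ← Finset.sum_add_distrib]
  refine Finset.sum_congr rfl fun x _ => ?_
  rw [Finsupp.add_apply, Finsupp.smul_apply, Finsupp.smul_apply, smul_eq_mul, smul_eq_mul,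
    ENNReal.ofReal_add (mul_nonneg ha (hp₁.1 x)) (mul_nonneg hb (hp₂.1 x)),
    ENNReal.ofReal_mul ha, ENNReal.ofReal_mul hb]
  ring

end Prior

/-! ### Existence and uniqueness of Augustin means -/

section Means

variable {X Y : Type*} [MeasurableSpace Y] {α : ℝ} {W : X → ProbabilityMeasure Y} {p : X →₀ ℝ}

theorem isCauchyTV_of_sq_le {m : ℕ → ProbabilityMeasure Y} {c : ℝ} (hc : 0 < c) {u : ℕ → ℝ}
    (hu : Tendsto u atTop (𝓝 0)) (h : ∀ i j, c * tvDist (m i) (m j) ^ 2 ≤ u i + u j) :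
    IsCauchyTV m := by
  intro ε hε
  obtain ⟨N, hN⟩ := eventually_atTop.1
    (hu.eventually (gt_mem_nhds (show 0 < c * ε ^ 2 / 2 by positivity)))
  refine ⟨N, fun i hi j hj => lt_of_pow_lt_pow_left₀ 2 hε.le ?_⟩
  refine lt_of_mul_lt_mul_left ((h i j).trans_lt ?_) hc.le
  linarith [hN i hi, hN j hj]

theorem tendsto_tvDist_of_sq_le {m m' : ℕ → ProbabilityMeasure Y} {c : ℝ} (hc : 0 < c)
    {u : ℕ → ℝ} (hu : Tendsto u atTop (𝓝 0)) (h : ∀ n, c * tvDist (m n) (m' n) ^ 2 ≤ u n) :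
    Tendsto (fun n => tvDist (m n) (m' n)) atTop (𝓝 0) := by
  have h1 : Tendsto (fun n => √(u n / c)) atTop (𝓝 0) := by
    have h2 := (hu.div_const c).sqrt
    simpa using h2
  exact squeeze_zero (fun n => tvDist_nonneg _ _)
    (fun n => Real.le_sqrt_of_sq_le ((le_div_iff₀' hc).2 (h n))) h1

theorem exists_isMean (h0 : 0 < α) (h1 : α ≤ 1) (hp : p ∈ priors X) : ∃ q, IsMean α W p q := by
  have hI := information_ne_top (W := W) h0 h1 hp
  have hpos : ∀ n : ℕ, (0 : ℝ) < 1 / ((n : ℝ) + 1) := fun n => Nat.one_div_pos_of_nat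
  have hex : ∀ n : ℕ, ∃ q, condRenyiDiv α W q p ≤
      information α W p + ENNReal.ofReal (1 / ((n : ℝ) + 1)) := fun n => by
    obtain ⟨q, hq⟩ := iInf_lt_iff.1 (show information α W p <
      information α W p + ENNReal.ofReal (1 / ((n : ℝ) + 1)) from
      ENNReal.lt_add_right hI (ENNReal.ofReal_pos.2 (hpos n)).ne')
    exact ⟨q, hq.le⟩
  choose m hm using hex
  have hu : Tendsto (fun n : ℕ => 1 / ((n : ℝ) + 1)) atTop (𝓝 0) :=
    tendsto_one_div_add_atTop_nhds_zero_nat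
  have hcau : IsCauchyTV m := by
    refine isCauchyTV_of_sq_le (c := 2 * (α / 64)) (by positivity) hu fun i j => ?_
    have h := (two_mul_information_add_le h0 h1 hp (m i) (m j)).trans
      (add_le_add (hm i) (hm j))
    rw [mul_add, two_mul, add_add_add_comm, ENNReal.add_le_add_iff_left
      (ENNReal.add_ne_top.2 ⟨hI, hI⟩), ← ENNReal.ofReal_add (hpos i).le (hpos j).le,
      show (2 : ℝ≥0∞) = ENNReal.ofReal 2 by simp, ← ENNReal.ofReal_mul (by norm_num),
      ENNReal.ofReal_le_ofReal_iff (add_pos (hpos i) (hpos j)).le] at h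
    linarith
  obtain ⟨q, hq⟩ := exists_tendsto_tvDist hcau
  refine ⟨q, le_antisymm (information_le q) (condRenyiDiv_le_of_tendsto h0 h1 hq ?_ hm)⟩
  simpa using (ENNReal.tendsto_ofReal hu).const_add (information α W p)

/-- Uniform convexity between `m` and `q`: one of the two copies of the information cancels against
the divergence at `m`. -/
theorem IsMean.add_le (h0 : 0 < α) (h1 : α ≤ 1) (hp : p ∈ priors X) {m : ProbabilityMeasure Y}
    (hm : IsMean α W p m) (q : ProbabilityMeasure Y) :
    information α W p + ENNReal.ofReal (2 * (α / 64) * tvDist m q ^ 2) ≤ condRenyiDiv α W q p := by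
  have h := two_mul_information_add_le (W := W) h0 h1 hp m q
  rw [← hm, mul_add, two_mul, add_assoc,
    ENNReal.add_le_add_iff_left (information_ne_top h0 h1 hp)] at h
  rwa [mul_assoc, ENNReal.ofReal_mul zero_le_two, ENNReal.ofReal_ofNat]

theorem IsMean.toReal_add_le (h0 : 0 < α) (h1 : α ≤ 1) (hp : p ∈ priors X)
    {m : ProbabilityMeasure Y} (hm : IsMean α W p m) {q : ProbabilityMeasure Y}
    (hq : condRenyiDiv α W q p ≠ ⊤) :
    (information α W p).toReal + 2 * (α / 64) * tvDist m q ^ 2 ≤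
      (condRenyiDiv α W q p).toReal := by
  have h := ENNReal.toReal_mono hq (hm.add_le h0 h1 hp q)
  rwa [ENNReal.toReal_add (information_ne_top h0 h1 hp) ENNReal.ofReal_ne_top,
    ENNReal.toReal_ofReal (by positivity)] at h

theorem IsMean.unique (h0 : 0 < α) (h1 : α ≤ 1) (hp : p ∈ priors X)
    {m q : ProbabilityMeasure Y} (hm : IsMean α W p m) (hq : IsMean α W p q) : m = q := by
  have hne : condRenyiDiv α W q p ≠ ⊤ := hq ▸ information_ne_top h0 h1 hp
  have h := hm.toReal_add_le h0 h1 hp hne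
  rw [hq] at h
  have h2 : tvDist m q ^ 2 ≤ 0 := by
    by_contra! hlt
    have : 0 < 2 * (α / 64) * tvDist m q ^ 2 := by positivity
    linarith
  exact eq_of_tvDist_le_zero (pow_eq_zero_iff two_ne_zero |>.1
    (le_antisymm h2 (sq_nonneg _))).le

end Means

/-! ### Existence, uniqueness and attraction of the Augustin center -/

section Center

variable {X Y : Type*} [MeasurableSpace Y] {α : ℝ} {W : X → ProbabilityMeasure Y}
  {A : Set (X →₀ ℝ)}

theorem information_le_capacity {p : X →₀ ℝ} (hp : p ∈ A) :
    information α W p ≤ capacity α W A := le_iSup₂ (f := fun p _ => information α W p) p hp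

theorem toReal_information_le {p : X →₀ ℝ} (hC : capacity α W A ≠ ⊤) (hp : p ∈ A) :
    (information α W p).toReal ≤ (capacity α W A).toReal :=
  ENNReal.toReal_mono hC (information_le_capacity hp)

theorem isCenter_iff {q : ProbabilityMeasure Y} :
    IsCenter α W A q ↔ ∀ p ∈ A, condRenyiDiv α W q p ≤ capacity α W A := by
  constructor
  · intro h p hp
    rw [h]
    exact le_iSup₂ (f := fun p _ => condRenyiDiv α W q p) p hp
  · exact fun h => le_antisymm (iSup₂_mono fun p _ => information_le q) (iSup₂_le h)

theorem exists_capacity_sub_le (hne : A.Nonempty) (hC : capacity α W A ≠ ⊤) {ε : ℝ}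
    (hε : 0 < ε) :
    ∃ p ∈ A, (capacity α W A).toReal - (information α W p).toReal ≤ ε := by
  by_contra! h
  obtain ⟨p₀, hp₀⟩ := hne
  have h₀ : (0 : ℝ) ≤ (information α W p₀).toReal := ENNReal.toReal_nonneg
  -- Nonemptiness of `A` enters here: it rules out truncation by `ENNReal.ofReal`.
  have hpos : 0 ≤ (capacity α W A).toReal - ε := by linarith [h p₀ hp₀]
  have hle : capacity α W A ≤ ENNReal.ofReal ((capacity α W A).toReal - ε) := by
    refine iSup₂_le fun p hp => ?_
    rw [← ENNReal.ofReal_toReal (ne_top_of_le_ne_top hC (information_le_capacity hp))]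
    exact ENNReal.ofReal_le_ofReal (by linarith [h p hp])
  have := ENNReal.toReal_mono ENNReal.ofReal_ne_top hle
  rw [ENNReal.toReal_ofReal hpos] at this
  linarith

/-- The mean of a mixture of two priors in `A` has small divergence with respect to both. -/
theorem exists_mixture_le (h0 : 0 < α) (h1 : α ≤ 1) (hA : A ⊆ priors X) (hconv : Convex ℝ A)
    (hC : capacity α W A ≠ ⊤) {p₁ p₂ : X →₀ ℝ} (hp₁ : p₁ ∈ A) (hp₂ : p₂ ∈ A) {a b : ℝ}
    (ha : 0 < a) (hb : 0 < b) (hab : a + b = 1) :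
    ∃ q, condRenyiDiv α W q p₁ ≠ ⊤ ∧ condRenyiDiv α W q p₂ ≠ ⊤ ∧
      a * (condRenyiDiv α W q p₁).toReal + b * (condRenyiDiv α W q p₂).toReal ≤
        (capacity α W A).toReal := by
  have hmem := hconv hp₁ hp₂ ha.le hb.le hab
  obtain ⟨q, hq⟩ := exists_isMean (W := W) h0 h1 (hA hmem)
  have h := information_le_capacity (α := α) (W := W) hmem
  rw [hq, condRenyiDiv_combination (hA hp₁) (hA hp₂) ha.le hb.le] at h
  obtain ⟨t1, t2⟩ := ENNReal.add_ne_top.1 (ne_top_of_le_ne_top hC h)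
  have h' := ENNReal.toReal_mono hC h
  rw [ENNReal.toReal_add t1 t2, ENNReal.toReal_mul, ENNReal.toReal_mul,
    ENNReal.toReal_ofReal ha.le, ENNReal.toReal_ofReal hb.le] at h'
  refine ⟨q, fun ht => t1 ?_, fun ht => t2 ?_, h'⟩
  · rw [ht, ENNReal.mul_top (ENNReal.ofReal_pos.2 ha).ne']
  · rw [ht, ENNReal.mul_top (ENNReal.ofReal_pos.2 hb).ne']

/-- Both means are compared with the mean `q` of the equal mixture, for which the two divergences
sum to at most `2 * C`; quadratic growth bounds both distances to `q`. -/
theorem sq_tvDist_means_le (h0 : 0 < α) (h1 : α ≤ 1) (hA : A ⊆ priors X) (hconv : Convex ℝ A)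
    (hC : capacity α W A ≠ ⊤) {p₁ p₂ : X →₀ ℝ} (hp₁ : p₁ ∈ A) (hp₂ : p₂ ∈ A)
    {m₁ m₂ : ProbabilityMeasure Y} (hm₁ : IsMean α W p₁ m₁) (hm₂ : IsMean α W p₂ m₂) :
    α / 64 * tvDist m₁ m₂ ^ 2 ≤
      ((capacity α W A).toReal - (information α W p₁).toReal) +
        ((capacity α W A).toReal - (information α W p₂).toReal) := by
  obtain ⟨q, t1, t2, h⟩ := exists_mixture_le h0 h1 hA hconv hC hp₁ hp₂
    (show (0 : ℝ) < 1 / 2 by norm_num) (show (0 : ℝ) < 1 / 2 by norm_num) (by norm_num)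
  have e1 := hm₁.toReal_add_le h0 h1 (hA hp₁) t1
  have e2 := hm₂.toReal_add_le h0 h1 (hA hp₂) t2
  have e3 := tvDist_triangle m₁ q m₂
  rw [tvDist_comm q m₂] at e3
  have e4 : tvDist m₁ m₂ ^ 2 ≤ 2 * (tvDist m₁ q ^ 2 + tvDist m₂ q ^ 2) := by
    have := pow_le_pow_left₀ (tvDist_nonneg _ _) e3 2
    nlinarith [sq_nonneg (tvDist m₁ q - tvDist m₂ q)]
  have e5 := mul_le_mul_of_nonneg_left e4 (show 0 ≤ α / 64 by positivity)
  linarith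

theorem exists_isCenter (h0 : 0 < α) (h1 : α ≤ 1) (hA : A ⊆ priors X) (hconv : Convex ℝ A)
    (hne : A.Nonempty) (hC : capacity α W A ≠ ⊤) : ∃ q, IsCenter α W A q := by
  -- The weight of the competing prior. The shift by two gives `l n ≤ 1 / 2`, so the main weight `1
  -- - l n` stays away from zero.
  let l : ℕ → ℝ := fun n => 1 / ((n : ℝ) + 1 + 1)
  have hl0 : ∀ n, 0 < l n := fun n => by positivity
  have hl2 : ∀ n, l n ≤ 1 / 2 := fun n =>
    one_div_le_one_div_of_le two_pos (by linarith [n.cast_nonneg (α := ℝ)])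
  have hl : Tendsto l atTop (𝓝 0) := by
    have h := (tendsto_add_atTop_iff_nat 1).2 (tendsto_one_div_add_atTop_nhds_zero_nat (𝕜 := ℝ))
    simpa [l] using h
  -- The deficit `l n ^ 2` is of smaller order than the weight, so it still vanishes after the later
  -- division by `l n`.
  choose p hpA hp using fun n => exists_capacity_sub_le (α := α) (W := W) hne hC
    (pow_pos (hl0 n) 2)
  choose m hm using fun n => exists_isMean (W := W) h0 h1 (hA (hpA n))
  have hl' : Tendsto (fun n => l n ^ 2) atTop (𝓝 0) := by simpa using hl.pow 2
  obtain ⟨qc, hqc⟩ := exists_tendsto_tvDist (isCauchyTV_of_sq_le (show 0 < α / 64 by positivity)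
    hl' fun i j => (sq_tvDist_means_le h0 h1 hA hconv hC (hpA i) (hpA j) (hm i) (hm j)).trans
      (add_le_add (hp i) (hp j)))
  refine ⟨qc, isCenter_iff.2 fun p' hp' => ?_⟩
  choose q t1 t2 hq using fun n => exists_mixture_le h0 h1 hA hconv hC (hpA n) hp'
    (show 0 < 1 - l n by linarith [hl2 n]) (hl0 n) (by ring)
  have hC0 : 0 ≤ (capacity α W A).toReal := ENNReal.toReal_nonneg
  have hmq : Tendsto (fun n => tvDist (m n) (q n)) atTop (𝓝 0) := by
    refine tendsto_tvDist_of_sq_le (c := α / 64) (by positivity)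
      (u := fun n => l n * (capacity α W A).toReal + l n ^ 2)
      (by simpa using (hl.mul_const _).add hl') fun n => ?_
    have e1 := (hm n).toReal_add_le h0 h1 (hA (hpA n)) (t1 n)
    have e2 : 0 ≤ l n * (condRenyiDiv α W (q n) p').toReal :=
      mul_nonneg (hl0 n).le ENNReal.toReal_nonneg
    have e3 : 0 ≤ α / 64 * tvDist (m n) (q n) ^ 2 := by positivity
    have e4 : (capacity α W A).toReal - l n ^ 2 + 2 * (α / 64) * tvDist (m n) (q n) ^ 2 ≤
        (condRenyiDiv α W (q n) (p n)).toReal := by linarith [hp n]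
    have e5 := mul_le_mul_of_nonneg_left e4 (show 0 ≤ 1 - l n by linarith [hl2 n])
    have e6 : 0 ≤ l n * l n ^ 2 := by have := hl0 n; positivity
    have e7 := mul_le_mul_of_nonneg_right (hl2 n) e3
    linarith [hq n]
  have hqqc : Tendsto (fun n => tvDist (q n) qc) atTop (𝓝 0) := by
    refine squeeze_zero (fun n => tvDist_nonneg _ _) (fun n => ?_)
      (by simpa using hmq.add hqc)
    have := tvDist_triangle (q n) (m n) qc
    rwa [tvDist_comm (q n) (m n)] at this
  refine condRenyiDiv_le_of_tendsto h0 h1 hqqc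
    (u := fun n => ENNReal.ofReal ((capacity α W A).toReal + l n)) ?_ fun n => ?_
  · have h := ENNReal.tendsto_ofReal (hl.const_add (capacity α W A).toReal)
    rwa [add_zero, ENNReal.ofReal_toReal hC] at h
  · rw [← ENNReal.ofReal_toReal (t2 n)]
    refine ENNReal.ofReal_le_ofReal ?_
    have e1 := ENNReal.toReal_mono (t1 n) (information_le (q n))
    have e2 : (capacity α W A).toReal - l n ^ 2 ≤ (condRenyiDiv α W (q n) (p n)).toReal := by
      linarith [hp n]
    have e3 := mul_le_mul_of_nonneg_left e2 (show 0 ≤ 1 - l n by linarith [hl2 n])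
    -- From `(1 - l) * (C - l ^ 2) + l * D(q|p') ≤ C` follows `l * D(q|p') ≤ l * (C + l)`.
    refine le_of_mul_le_mul_left ?_ (hl0 n)
    have e6 : 0 ≤ l n * l n ^ 2 := by have := hl0 n; positivity
    nlinarith [hq n]

/-- The divergence of `qc` is squeezed: it is at most `C`, and at least the information plus a
multiple of the squared distance from the mean. -/
theorem IsCenter.tendsto_means (h0 : 0 < α) (h1 : α ≤ 1) (hA : A ⊆ priors X)
    (hC : capacity α W A ≠ ⊤) {qc : ProbabilityMeasure Y} (hqc : IsCenter α W A qc)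
    {p : ℕ → (X →₀ ℝ)} (hp : ∀ n, p n ∈ A)
    (hlim : Tendsto (fun n => information α W (p n)) atTop (𝓝 (capacity α W A)))
    {m : ℕ → ProbabilityMeasure Y} (hm : ∀ n, IsMean α W (p n) (m n)) :
    Tendsto (fun n => tvDist (m n) qc) atTop (𝓝 0) := by
  have hreal := (ENNReal.tendsto_toReal hC).comp hlim
  refine tendsto_tvDist_of_sq_le (m' := fun _ => qc) (c := 2 * (α / 64)) (by positivity)
    (u := fun n => (capacity α W A).toReal - (information α W (p n)).toReal)
    (by simpa using hreal.const_sub (capacity α W A).toReal) fun n => ?_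
  have h := isCenter_iff.1 hqc (p n) (hp n)
  have h1 := (hm n).toReal_add_le h0 h1 (hA (hp n)) (ne_top_of_le_ne_top hC h)
  linarith [ENNReal.toReal_mono hC h]

/-- Every center is the limit of one and the same sequence of means. -/
theorem IsCenter.unique (h0 : 0 < α) (h1 : α ≤ 1) (hA : A ⊆ priors X) (hne : A.Nonempty)
    (hC : capacity α W A ≠ ⊤) {q q' : ProbabilityMeasure Y} (hq : IsCenter α W A q)
    (hq' : IsCenter α W A q') : q = q' := by
  choose p hpA hp using fun n : ℕ => exists_capacity_sub_le (α := α) (W := W) hne hC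
    (Nat.one_div_pos_of_nat (α := ℝ) (n := n))
  choose m hm using fun n => exists_isMean (W := W) h0 h1 (hA (hpA n))
  have hlim : Tendsto (fun n => information α W (p n)) atTop (𝓝 (capacity α W A)) := by
    refine (ENNReal.tendsto_toReal_iff (fun n => information_ne_top h0 h1 (hA (hpA n))) hC).1 ?_
    have h := (tendsto_one_div_add_atTop_nhds_zero_nat (𝕜 := ℝ)).const_sub
      (capacity α W A).toReal
    rw [sub_zero] at h
    exact tendsto_of_tendsto_of_tendsto_of_le_of_le h tendsto_const_nhds
      (fun n => by linarith [hp n]) fun n => toReal_information_le hC (hpA n)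
  exact eq_of_tendsto_tvDist (hq.tendsto_means h0 h1 hA hC hpA hlim hm)
    (hq'.tendsto_means h0 h1 hA hC hpA hlim hm)

end Center

end Augustin

/-! ### The main theorem -/

theorem theorem2 {X Y : Type*} [MeasurableSpace Y] (α : ℝ) (hα0 : 0 < α) (hα1 : α ≤ 1)
    (W : X → ProbabilityMeasure Y) (A : Set (X →₀ ℝ)) (hA : A ⊆ Augustin.priors X)
    (hconv : Convex ℝ A) (hne : A.Nonempty) :
    -- minimax equality
    (⨆ p ∈ A, ⨅ q : ProbabilityMeasure Y, Augustin.condRenyiDiv α W q p) =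
        (⨅ q : ProbabilityMeasure Y, ⨆ p ∈ A, Augustin.condRenyiDiv α W q p) ∧
    -- every prior has exactly one Augustin mean
    (∀ p ∈ Augustin.priors X, ∃! q : ProbabilityMeasure Y, Augustin.IsMean α W p q) ∧
    (Augustin.capacity α W A < ⊤ →
      -- there is exactly one Augustin center
      (∃! qc : ProbabilityMeasure Y, Augustin.IsCenter α W A qc) ∧
      -- the Augustin means of a capacity-achieving sequence of priors converge to it
      ∀ qc : ProbabilityMeasure Y, Augustin.IsCenter α W A qc →
        ∀ p : ℕ → (X →₀ ℝ), (∀ n, p n ∈ A) →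
          Tendsto (fun n => Augustin.information α W (p n)) atTop (𝓝 (Augustin.capacity α W A)) →
          ∀ m : ℕ → ProbabilityMeasure Y, (∀ n, Augustin.IsMean α W (p n) (m n)) →
            Augustin.IsCauchyTV m ∧
            Tendsto (fun n => Augustin.tvDist (m n) qc) atTop (𝓝 0) ∧
            ∀ q : ProbabilityMeasure Y, Augustin.IsLimitPointTV m q ↔ q = qc) := by
  have hle : (⨆ p ∈ A, ⨅ q : ProbabilityMeasure Y, Augustin.condRenyiDiv α W q p) ≤
      ⨅ q : ProbabilityMeasure Y, ⨆ p ∈ A, Augustin.condRenyiDiv α W q p :=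
    iSup₂_le fun p hp => iInf_mono fun q =>
      le_iSup₂ (f := fun p _ => Augustin.condRenyiDiv α W q p) p hp
  refine ⟨le_antisymm hle ?_, fun p hp => ?_, fun hC => ⟨?_, ?_⟩⟩
  · by_cases hC : Augustin.capacity α W A = ⊤
    · exact le_top.trans_eq hC.symm
    -- Evaluating the outer infimum at a center gives exactly the capacity.
    · obtain ⟨q, hq⟩ := Augustin.exists_isCenter hα0 hα1 hA hconv hne hC
      exact (iInf_le _ q).trans hq.ge
  · obtain ⟨q, hq⟩ := Augustin.exists_isMean (W := W) hα0 hα1 hp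
    exact ⟨q, hq, fun q' hq' => hq'.unique hα0 hα1 hp hq⟩
  · obtain ⟨q, hq⟩ := Augustin.exists_isCenter hα0 hα1 hA hconv hne hC.ne
    exact ⟨q, hq, fun q' hq' => hq'.unique hα0 hα1 hA hne hC.ne hq⟩
  · intro qc hqc p hp hlim m hm
    have h := hqc.tendsto_means hα0 hα1 hA hC.ne hp hlim hm
    exact ⟨Augustin.isCauchyTV_of_tendsto h, h, fun q =>
      Augustin.isLimitPointTV_iff_of_tendsto h⟩
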